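/- Terminology. A decision tree over $x_1,\dots,x_n$ is a binary tree whose internal nodes query variables and whose leaves carry labels in $\{\pm1\}$; its size is its number of leaves. The decision tree size of $f:\{0,1\}^n\to\{\pm1\}$ is the least size of a decision tree that computes $f$. The influence of $x_i$ on $f$ is $\mathrm{Inf}_i(f)=\Pr_x[f(x)\ne f(x^{\oplus i})]$ for uniform $x\in\{0,1\}^n$, where $x^{\oplus i}$ is $x$ with its $i$-th coordinate flipped. A bare tree is a decision tree without leaf labels; its $f$-completion labels each leaf $\ell$ by $\mathrm{sign}(\mathbb E[f_\ell])$ (with, say, $\mathrm{sign}(0)=1$), where $f_\ell$ is the restriction of $f$ by the path leading to $\ell$. A function $g$ is an $\varepsilon$-approximation of $f$ if $\Pr_x[g(x)\ne f(x)]\le\varepsilon$. $\textsc{BuildTopDownDT}(f,\varepsilon)$ starts with the bare tree that is a single leaf. While the $f$-completion of the current bare tree is not an $\varepsilon$-approximation of $f$, it picks a leaf $\ell$ of maximal score $2^{-|\ell|}\max_j\mathrm{Inf}_j(f_\ell)$, where $|\ell|$ is the depth of $\ell$, and replaces $\ell$ by a query to a most influential variable of $f_\ell$. It returns the $f$-completion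 of the final bare tree. $\textsc{TopDownDTSize}(f,\varepsilon)$ is the size of the returned tree when ties (between variables and between leaves) are broken in the most favorable way, i.e. the least size over all tie-breakings; $\textsc{TopDownDTSize}(f)=\textsc{TopDownDTSize}(f,0)$. A pruning of a tree $T$ is a tree obtained from $T$ by replacing some subtrees by leaves, with any leaf labels. Theorem. (a) (Exact representation.) There are constants $c_1,c_2,c_3>0$ such that for every $n\ge1$ there is an $f:\{0,1\}^n\to\{\pm1\}$ whose decision tree size $s$ satisfies $c_1n\le s\le c_2n$ and for which $\textsc{TopDownDTSize}(f)\ge2^{c_3s}$. (b) (Approximate representation.) For all $C>0$ and $a\in\mathbb N$ there are $c>0$ and $b\in\mathbb N$ such that for every $\varepsilon\in(0,\frac12)$ there is an $s_0$ with the following property. For all $n,s\in\mathbb N$ with $s_0\le s\le2^{C\sqrt n\,(\log_2n)^a}$ there is an $f:\{0,1\}^n\to\{\pm1\}$ of decision tree size exactly $s$ such that $$\textsc{TopDownDTSize}(f,\varepsilon)\ \ge\ s^{\,c\log_2 s/(\log_2\log_2 s)^b},$$ and moreover, for every tree $T$ that $\textsc{BuildTopDownDT}(f,0)$ can return (for any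 way of breaking ties), every pruning of $T$ that is an $\varepsilon$-approximation of $f$ has size at least $s^{\,c\log_2 s/(\log_2\log_2 s)^b}$. In asymptotic notation: (a) $s=\Theta(n)$ and $\textsc{TopDownDTSize}(f)\ge2^{\Omega(s)}$; (b) for every $\varepsilon\in(0,\frac12)$ and every $s(n)\le2^{\tilde O(\sqrt n)}$ there is an $f$ of decision tree size $s$ with $\textsc{TopDownDTSize}(f,\varepsilon)\ge s^{\tilde\Omega(\log s)}$. -/

import Mathlib

namespace TopDown

/-- The functions `{0,1}^n → {±1}`. -/
abbrev BoolFn (n : ℕ) : Type := (Fin n → Bool) → ℤˣ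

/-- The probability of an event under the uniform distribution on `{0,1}^n`. -/
noncomputable def prob {n : ℕ} (P : (Fin n → Bool) → Prop) [DecidablePred P] : ℝ :=
  ((Finset.univ.filter P).card : ℝ) / 2 ^ n

/-- The point `x` with its `i`-th coordinate flipped. -/
def flipAt {n : ℕ} (x : Fin n → Bool) (i : Fin n) : Fin n → Bool :=
  Function.update x i (!(x i))

/-- The influence of the variable `i` on `f`: the probability that `f x ≠ f (flipAt x i)`. -/
noncomputable def influence {n : ℕ} (f : BoolFn n) (i : Fin n) : ℝ :=
  prob (fun x => f x ≠ f (flipAt x i))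

/-- The distance `Pr[f x ≠ g x]` between two functions. -/
noncomputable def error {n : ℕ} (f g : BoolFn n) : ℝ :=
  prob (fun x => f x ≠ g x)

/-- The subfunction of `f` obtained by fixing the variable `i` to the value `b`. It is still viewed
as a function on `{0,1}^n`, on which the variable `i` now has influence `0`. -/
def restrict {n : ℕ} (f : BoolFn n) (i : Fin n) (b : Bool) : BoolFn n :=
  fun x => f (Function.update x i b)

/-- The expectation of `f` under the uniform distribution. -/
noncomputable def expectation {n : ℕ} (f : BoolFn n) : ℝ :=
  (∑ x : Fin n → Bool, (((f x : ℤˣ) : ℤ) : ℝ)) / 2 ^ n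

/-- The sign of the expectation of `f`, where the sign of `0` is taken to be `1`. -/
noncomputable def majority {n : ℕ} (f : BoolFn n) : ℤˣ :=
  open Classical in if 0 ≤ expectation f then 1 else -1

/-- Binary trees whose internal nodes query one of `n` variables and whose leaves are labelled by
elements of `α`. In `node i t₀ t₁` the subtree `t₀` is for the answer `0`, `t₁` for `1`. -/
inductive DTree (n : ℕ) (α : Type) : Type
  | leaf (a : α) : DTree n α
  | node (i : Fin n) (t₀ t₁ : DTree n α) : DTree n α

/-- Decision trees for functions `{0,1}^n → {±1}`. -/
abbrev DecisionTree (n : ℕ) : Type := DTree n ℤˣ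

/-- Bare trees: decision trees with unlabelled leaves. -/
abbrev BareTree (n : ℕ) : Type := DTree n Unit

/-- The empty bare tree, which consists of one leaf. -/
def emptyTree (n : ℕ) : BareTree n := DTree.leaf ()

/-- The size of a tree: its number of leaves. -/
def DTree.size {n : ℕ} {α : Type} : DTree n α → ℕ
  | .leaf _ => 1
  | .node _ t₀ t₁ => t₀.size + t₁.size

/-- The function that a tree computes. -/
def DTree.eval {n : ℕ} {α : Type} : DTree n α → (Fin n → Bool) → α
  | .leaf a, _ => a
  | .node i t₀ t₁, x => if x i then t₁.eval x else t₀.eval x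

/-- The optimal decision tree size of `f`: the least size of a decision tree that computes `f`. -/
noncomputable def dtSize {n : ℕ} (f : BoolFn n) : ℕ :=
  sInf {s | ∃ T : DecisionTree n, T.eval = f ∧ T.size = s}

/-- The `f`-completion of a bare tree: every leaf is labelled by the sign of the expectation of the
restriction of `f` by the path that leads to the leaf. -/
noncomputable def completion {n : ℕ} : BoolFn n → BareTree n → DecisionTree n
  | f, .leaf _ => .leaf (majority f)
  | f, .node i t₀ t₁ =>
      .node i (completion (restrict f i false) t₀) (completion (restrict f i true) t₁)

/-- Root-to-node paths: the list of the queries on the path, from the root down, each with its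
answer. -/
abbrev Path (n : ℕ) : Type := List (Fin n × Bool)

/-- The paths to the leaves of a tree. The length of a path is the depth of its leaf. -/
def DTree.leafPaths {n : ℕ} {α : Type} : DTree n α → List (Path n)
  | .leaf _ => [[]]
  | .node i t₀ t₁ =>
      t₀.leafPaths.map (fun π => (i, false) :: π) ++ t₁.leafPaths.map (fun π => (i, true) :: π)

/-- The restriction of `f` by a path. -/
def restrictPath {n : ℕ} : BoolFn n → Path n → BoolFn n
  | f, [] => f
  | f, (i, b) :: π => restrictPath (restrict f i b) π

/-- The bare tree obtained by replacing the leaf at the end of the path `π` with a query to `j`.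
(The tree is unchanged if there is no leaf at the end of `π`.) -/
def splitLeaf {n : ℕ} : BareTree n → Path n → Fin n → BareTree n
  | .leaf _, [], j => .node j (.leaf ()) (.leaf ())
  | .leaf u, _ :: _, _ => .leaf u
  | .node i t₀ t₁, [], _ => .node i t₀ t₁
  | .node i t₀ t₁, (_, false) :: π, j => .node i (splitLeaf t₀ π j) t₁
  | .node i t₀ t₁, (_, true) :: π, j => .node i t₀ (splitLeaf t₁ π j)

/-- The variable `i` is a most influential variable of `f`. -/
def IsMostInfluential {n : ℕ} (f : BoolFn n) (i : Fin n) : Prop :=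
  ∀ j : Fin n, influence f j ≤ influence f i

/-- The score `2 ^ (-|ℓ|) * Inf_i (f_ℓ)` of a leaf `ℓ`, given by its path `π`, where `i` is a most
influential variable of the subfunction at the leaf. -/
noncomputable def score {n : ℕ} (f : BoolFn n) (π : Path n) (i : Fin n) : ℝ :=
  (1 / 2 : ℝ) ^ π.length * influence (restrictPath f π) i

/-- The bare trees that the top-down heuristic with input `(f, ε)` can hold at some point of its
run, for some way of breaking ties among variables and among leaves. -/
inductive Reachable {n : ℕ} (f : BoolFn n) (ε : ℝ) : BareTree n → Prop
  | init : Reachable f ε (emptyTree n)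
  | step (B : BareTree n) (π : Path n) (i : Fin n)
      (hB : Reachable f ε B)
      (herr : ¬ error (completion f B).eval f ≤ ε)
      (hπ : π ∈ B.leafPaths)
      (hi : IsMostInfluential (restrictPath f π) i)
      (hmax : ∀ π' ∈ B.leafPaths, ∀ i' : Fin n,
        IsMostInfluential (restrictPath f π') i' → score f π' i' ≤ score f π i) :
      Reachable f ε (splitLeaf B π i)

/-- `T` is a possible output of the top-down heuristic on `(f, ε)`, for some way of breaking ties:
the `f`-completion of a reachable bare tree at which the heuristic stops. -/
def IsTopDownOutput {n : ℕ} (f : BoolFn n) (ε : ℝ) (T : DecisionTree n) : Prop :=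
  ∃ B : BareTree n, Reachable f ε B ∧ error (completion f B).eval f ≤ ε ∧ T = completion f B

/-- The size of the tree that the top-down heuristic returns on `(f, ε)` when ties are broken in
the most favorable way, that is, the least size of a possible output. -/
noncomputable def topDownDTSize {n : ℕ} (f : BoolFn n) (ε : ℝ) : ℕ :=
  sInf {s | ∃ T : DecisionTree n, IsTopDownOutput f ε T ∧ T.size = s}

/-- `IsPruning S T`: the tree `S` is obtained from `T` by removing leaves in a bottom-up fashion,
that is, by replacing some subtrees of `T` with leaves. The labels of the leaves of `S` are
arbitrary. -/
inductive IsPruning {n : ℕ} {α β : Type} : DTree n α → DTree n β → Prop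
  | leaf (a : α) (T : DTree n β) : IsPruning (.leaf a) T
  | node (i : Fin n) (s₀ s₁ : DTree n α) (t₀ t₁ : DTree n β)
      (h₀ : IsPruning s₀ t₀) (h₁ : IsPruning s₁ t₁) :
      IsPruning (.node i s₀ s₁) (.node i t₀ t₁)

end TopDown

/-! The greedy rule sees only influences, so it postpones variables that an efficient tree reads
early whenever a single flip of them rarely matters. The heuristic enters only through
`QueriesInfluential`: every node queries a most influential variable, of positive influence. This
property ignores the order in which leaves are split and passes to completions and prunings. A size
bound for all such trees therefore covers every tie-breaking and also the prunings in (b).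

(a) In `chainFn` the majority of three bits chooses one of two chains, the first 0 of the chosen
chain points to an index `i`, and the value is the conjunction of the `i`-th pair. Reading the three
bits, then one chain, then one pair takes linear size. But the pairs are shared by both chains,
while a choice bit is pivotal, and a given chain is chosen, only half of the time. Hence a variable
of the first open pair is always strictly the most influential one. Greedy trees query the pairs in
order, and each pair leads along two branches to the same problem for the next index, so the size
doubles at each index (`two_pow_le_size_of_eval_eq_chainFn`).

(b) In `selectedParity` a selector names one of `2 ^ p` blocks of `m` variables, and the value is
the parity of that block. Reading the selector and then one block is cheap. The selector is built so
that each of its bits matters with probability less than `ρ`, the probability that a given block is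
selected, whereas every unqueried block variable matters with at least that probability. So a greedy
path exhausts all blocks before it touches the selector (`blocksFirst_concat`). A leaf of depth
below a suitable `d` leaves most parities undetermined and errs on almost half of its inputs, which
forces about `2 ^ d` leaves (`le_error`, `le_size`). Up to powers of `log log s`, both `m` and `2 ^
p` are `log s`, so `d` is `(log s)²`; this is also the number of variables, whence the restriction
on `s`.

To reach size exactly `s`, `t` disjoint copies sit behind a chain of gates whose fallback, of weight
only `(1/2) ^ t`, is a padding function of prescribed size. Sizes add up across a gate between
functions of disjoint variables (`dtSize_mux`, `exists_dtSize_eq`). -/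

namespace TopDown
open Finset

/-! ### Probabilities -/

/-- The probability of an event, with classical decidability. -/
noncomputable def pr {n : ℕ} (P : (Fin n → Bool) → Prop) : ℝ :=
  open Classical in prob P

lemma prob_eq_pr {n : ℕ} (P : (Fin n → Bool) → Prop) [DecidablePred P] : prob P = pr P := by
  unfold pr prob
  congr!

lemma influence_eq {n : ℕ} (f : BoolFn n) (i : Fin n) :
    influence f i = pr (fun x => f x ≠ f (flipAt x i)) := prob_eq_pr _

lemma error_eq {n : ℕ} (f g : BoolFn n) : error f g = pr (fun x => f x ≠ g x) := prob_eq_pr _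

lemma pr_def {n : ℕ} (P : (Fin n → Bool) → Prop) [DecidablePred P] :
    pr P = ((univ.filter P).card : ℝ) / 2 ^ n := by
  unfold pr prob
  congr!

lemma pr_nonneg {n : ℕ} (P : (Fin n → Bool) → Prop) : 0 ≤ pr P := by
  classical
  rw [pr_def]; positivity

lemma pr_mono {n : ℕ} {P Q : (Fin n → Bool) → Prop} (h : ∀ x, P x → Q x) : pr P ≤ pr Q := by
  classical
  rw [pr_def, pr_def]
  gcongr
  exact fun h' => h _ h'

lemma pr_congr {n : ℕ} {P Q : (Fin n → Bool) → Prop} (h : ∀ x, P x ↔ Q x) : pr P = pr Q :=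
  le_antisymm (pr_mono fun x => (h x).1) (pr_mono fun x => (h x).2)

lemma pr_of_forall {n : ℕ} {P : (Fin n → Bool) → Prop} (h : ∀ x, P x) : pr P = 1 := by
  classical
  rw [pr_def, filter_true_of_mem fun x _ => h x]
  simp

lemma pr_of_forall_not {n : ℕ} {P : (Fin n → Bool) → Prop} (h : ∀ x, ¬ P x) : pr P = 0 := by
  classical
  rw [pr_def, filter_false_of_mem fun x _ => h x]
  simp

lemma pr_le_one {n : ℕ} (P : (Fin n → Bool) → Prop) : pr P ≤ 1 :=
  (pr_mono fun _ _ => trivial).trans_eq (pr_of_forall (P := fun _ => True) fun _ => trivial)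

lemma pr_pos {n : ℕ} {P : (Fin n → Bool) → Prop} {x : Fin n → Bool} (h : P x) : 0 < pr P := by
  classical
  rw [pr_def]
  have : 0 < (univ.filter P).card := card_pos.2 ⟨x, by simpa using h⟩
  positivity

lemma exists_of_pr_pos {n : ℕ} {P : (Fin n → Bool) → Prop} (h : 0 < pr P) : ∃ x, P x := by
  by_contra! h'
  rw [pr_of_forall_not h'] at h
  exact lt_irrefl _ h

lemma pr_or_le {n : ℕ} (P Q : (Fin n → Bool) → Prop) :
    pr (fun x => P x ∨ Q x) ≤ pr P + pr Q := by
  classical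
  rw [pr_def, pr_def, pr_def, ← add_div, filter_or]
  gcongr
  exact_mod_cast card_union_le _ _

lemma pr_exists_le {n : ℕ} {ι : Type*} (s : Finset ι) (P : ι → (Fin n → Bool) → Prop) :
    pr (fun x => ∃ i ∈ s, P i x) ≤ ∑ i ∈ s, pr (P i) := by
  classical
  induction s using Finset.induction_on with
  | empty => rw [pr_of_forall_not (by simp)]; simp
  | insert a s ha ih =>
    rw [sum_insert ha]
    refine (pr_mono (Q := fun x => P a x ∨ ∃ i ∈ s, P i x) ?_).trans ((pr_or_le _ _).trans ?_)
    · intro x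
      simp
    · gcongr

lemma pr_comp_equiv {n : ℕ} (σ : (Fin n → Bool) ≃ (Fin n → Bool)) (P : (Fin n → Bool) → Prop) :
    pr (fun x => P (σ x)) = pr P := by
  classical
  rw [pr_def, pr_def]
  congr 2
  refine card_bij (fun x _ => σ x) ?_ ?_ ?_
  · simp
  · simp
  · intro y hy
    exact ⟨σ.symm y, by simpa using hy, by simp⟩

lemma flipAt_flipAt {n : ℕ} (x : Fin n → Bool) (i : Fin n) : flipAt (flipAt x i) i = x := by
  simp [flipAt]

lemma flipAt_same {n : ℕ} (x : Fin n → Bool) (i : Fin n) : flipAt x i i = !(x i) := by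
  simp [flipAt]

lemma flipAt_of_ne {n : ℕ} (x : Fin n → Bool) {i j : Fin n} (h : j ≠ i) : flipAt x i j = x j := by
  simp [flipAt, h]

lemma pr_flipAt {n : ℕ} (i : Fin n) (P : (Fin n → Bool) → Prop) :
    pr (fun x => P (flipAt x i)) = pr P :=
  pr_comp_equiv (Function.Involutive.toPerm (fun x => flipAt x i) fun x => flipAt_flipAt x i) P

lemma pr_and_add_pr_and_not {n : ℕ} (P Q : (Fin n → Bool) → Prop) :
    pr (fun x => P x ∧ Q x) + pr (fun x => P x ∧ ¬ Q x) = pr P := by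
  classical
  rw [pr_def, pr_def, pr_def, ← add_div, ← filter_filter, ← filter_filter]
  congr 1
  exact_mod_cast card_filter_add_card_filter_not (s := univ.filter P) Q

lemma sum_pr_and_eq {n : ℕ} {ν : Type*} [Fintype ν] (P : (Fin n → Bool) → Prop)
    (h : (Fin n → Bool) → ν) : ∑ v, pr (fun x => P x ∧ h x = v) = pr P := by
  classical
  simp_rw [pr_def]
  rw [← sum_div, card_eq_sum_card_fiberwise (f := h) (t := univ) (by simp)]
  push_cast
  simp_rw [filter_filter]

lemma pr_split {n : ℕ} (i : Fin n) (P : (Fin n → Bool) → Prop) :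
    pr P = (pr (fun x => P (Function.update x i false)) +
      pr (fun x => P (Function.update x i true))) / 2 := by
  -- The flip of coordinate `i` maps the half `x i ≠ b` onto the half `x i = b`, and the updated
  -- point is the same for both.
  have key : ∀ b : Bool, pr (fun x => P (Function.update x i b)) =
      2 * pr (fun x => P x ∧ x i = b) := by
    intro b
    rw [← pr_and_add_pr_and_not _ (fun x => x i = b), two_mul]
    congr 1
    · refine pr_congr fun x => ?_
      constructor
      · rintro ⟨h, rfl⟩
        exact ⟨by simpa using h, rfl⟩
      · rintro ⟨h, rfl⟩
        exact ⟨by simpa using h, rfl⟩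
    · rw [← pr_flipAt i (fun x => P x ∧ x i = b)]
      refine pr_congr fun x => ?_
      rw [flipAt_same]
      constructor
      · rintro ⟨h, h'⟩
        have : (!(x i)) = b := by cases hx : x i <;> cases b <;> simp_all
        exact ⟨by unfold flipAt; rwa [this], this⟩
      · rintro ⟨h, rfl⟩
        exact ⟨h, by simp⟩
  rw [key, key, ← pr_and_add_pr_and_not P (fun x => x i = false)]
  simp only [Bool.not_eq_false]
  ring

-- On pairs of points, `sw` exchanges the coordinates outside `A`. This bijection turns `P x ∧ Q x`
-- into `P x ∧ Q y`.
open Classical in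
lemma pr_and_of_dependsOn {n : ℕ} {P Q : (Fin n → Bool) → Prop} {A : Set (Fin n)}
    (hP : DependsOn P A) (hQ : DependsOn Q Aᶜ) :
    pr (fun x => P x ∧ Q x) = pr P * pr Q := by
  let sw : (Fin n → Bool) × (Fin n → Bool) → (Fin n → Bool) × (Fin n → Bool) :=
    fun p => (fun i => if i ∈ A then p.1 i else p.2 i, fun i => if i ∈ A then p.2 i else p.1 i)
  have hsw : ∀ p, sw (sw p) = p := by
    rintro ⟨x, y⟩
    ext i <;> by_cases hi : i ∈ A <;> simp [sw, hi]
  have h1 : ∀ p, P (sw p).1 = P p.1 := fun p => hP fun i hi => by simp [sw, hi]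
  have h2 : ∀ p, Q (sw p).2 = Q p.1 := fun p => hQ fun i hi => by
    have : i ∉ A := hi
    simp [sw, this]
  have hcard : ((univ.filter fun x => P x ∧ Q x) ×ˢ (univ : Finset (Fin n → Bool))).card =
      ((univ.filter P) ×ˢ (univ.filter Q)).card := by
    refine card_bij (fun p _ => sw p) ?_ ?_ ?_
    · intro p hp
      simp only [mem_product, mem_filter, mem_univ, true_and, and_true] at hp ⊢
      rw [h1, h2]
      exact hp
    · intro p _ q _ h
      rw [← hsw p, h, hsw]
    · intro p hp
      refine ⟨sw p, ?_, hsw p⟩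
      simp only [mem_product, mem_filter, mem_univ, true_and, and_true] at hp ⊢
      rw [← h1, ← h2, hsw]
      exact hp
  rw [card_product, card_product] at hcard
  rw [pr_def, pr_def, pr_def]
  have h3 : ((univ : Finset (Fin n → Bool)).card : ℝ) = 2 ^ n := by simp
  have h4 : ((univ.filter fun x => P x ∧ Q x).card : ℝ) * 2 ^ n =
      (univ.filter P).card * (univ.filter Q).card := by
    rw [← h3]; exact_mod_cast hcard
  field_simp
  linarith

lemma pr_eq_half {n : ℕ} (i : Fin n) (b : Bool) : pr (fun x => x i = b) = 1 / 2 := by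
  rw [pr_split i]
  cases b
  · rw [pr_of_forall (by simp), pr_of_forall_not (by simp)]; norm_num
  · rw [pr_of_forall_not (by simp), pr_of_forall (by simp)]; norm_num

lemma pr_subcube {n : ℕ} (s : Finset (Fin n)) (c : Fin n → Bool) :
    pr (fun x => ∀ i ∈ s, x i = c i) = (1 / 2) ^ s.card := by
  induction s using Finset.induction_on with
  | empty => rw [pr_of_forall (by simp)]; simp
  | insert a s ha ih =>
    rw [card_insert_of_notMem ha, pow_succ', ← ih, ← pr_eq_half a (c a),
      ← pr_and_of_dependsOn (A := {a})]
    · exact pr_congr fun x => by simp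
    · intro x y h
      simp [h a rfl]
    · intro x y h
      have : ∀ i ∈ s, x i = y i := fun i hi => h i (by rintro rfl; exact ha hi)
      simp only [eq_iff_iff]
      exact forall₂_congr fun i hi => by rw [this i hi]

-- Reduces events about a few variables to counts on a small cube, which `decide` can evaluate.
open Classical in
lemma pr_comp_injective {n : ℕ} {κ : Type*} [Fintype κ] {e : κ → Fin n}
    (he : Function.Injective e) (P : (κ → Bool) → Prop) :
    pr (fun x => P (fun k => x (e k))) = ((univ.filter P).card : ℝ) / 2 ^ Fintype.card κ := by
  have key : ∀ v : κ → Bool, pr (fun x => P (fun k => x (e k)) ∧ (fun k => x (e k)) = v) =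
      if P v then (1 / 2) ^ Fintype.card κ else 0 := by
    intro v
    split_ifs with hv
    · rw [← card_univ, ← card_map ⟨e, he⟩, ← pr_subcube _ (Function.extend e v fun _ => false)]
      refine pr_congr fun x => ?_
      simp only [mem_map, mem_univ, true_and, Function.Embedding.coeFn_mk, forall_exists_index,
        forall_apply_eq_imp_iff, he.extend_apply]
      constructor
      · rintro ⟨-, rfl⟩ k
        rfl
      · intro h
        have : (fun k => x (e k)) = v := funext h
        exact ⟨this ▸ hv, this⟩
    · refine pr_of_forall_not ?_
      rintro x ⟨h, rfl⟩
      exact hv h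
  rw [← sum_pr_and_eq _ (fun x => fun k => x (e k))]
  simp_rw [key]
  rw [← sum_filter, sum_const, nsmul_eq_mul, one_div, inv_pow, div_eq_mul_inv]

/-! ### Trees that query influential variables -/

lemma influence_eq_zero_iff {n : ℕ} {f : BoolFn n} {i : Fin n} :
    influence f i = 0 ↔ ∀ x b, f (Function.update x i b) = f x := by
  rw [influence_eq]
  constructor
  · intro h x b
    by_contra hne
    by_cases hb : b = x i
    · subst hb; simp at hne
    · have hb' : b = !(x i) := by cases b <;> cases h' : x i <;> simp_all
      have := pr_pos (P := fun x => f x ≠ f (flipAt x i)) (x := x)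
        (by subst hb'; exact fun h => hne h.symm)
      linarith
  · intro h
    refine pr_of_forall_not fun x => ?_
    simp [flipAt, h]

lemma influence_nonneg {n : ℕ} (f : BoolFn n) (i : Fin n) : 0 ≤ influence f i := by
  rw [influence_eq]; exact pr_nonneg _

lemma influence_restrict_self {n : ℕ} (f : BoolFn n) (i : Fin n) (b : Bool) :
    influence (restrict f i b) i = 0 := by
  rw [influence_eq_zero_iff]
  intro x c
  simp [restrict]

lemma influence_restrict_eq_zero {n : ℕ} {f : BoolFn n} {j : Fin n} (h : influence f j = 0)
    (i : Fin n) (b : Bool) : influence (restrict f i b) j = 0 := by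
  rw [influence_eq_zero_iff] at h ⊢
  intro x c
  by_cases hij : i = j
  · subst hij; simp [restrict]
  · simp [restrict, Function.update_comm (Ne.symm hij), h]

/-- Every internal node of the tree queries a most influential variable, of positive influence, of
the subfunction of `f` at that node. -/
def QueriesInfluential {n : ℕ} {α : Type} : BoolFn n → DTree n α → Prop
  | _, .leaf _ => True
  | f, .node i t₀ t₁ => (IsMostInfluential f i ∧ 0 < influence f i) ∧
      QueriesInfluential (restrict f i false) t₀ ∧ QueriesInfluential (restrict f i true) t₁

/-- Restrictions never give influence to a variable that has none, so such a variable is queried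
nowhere in the tree. -/
lemma QueriesInfluential.eval_update {n : ℕ} {α : Type} {T : DTree n α} {f : BoolFn n}
    (hT : QueriesInfluential f T) {i : Fin n} (hi : influence f i = 0) (x : Fin n → Bool)
    (b : Bool) : T.eval (Function.update x i b) = T.eval x := by
  induction T generalizing f with
  | leaf a => rfl
  | node j t₀ t₁ h₀ h₁ =>
    obtain ⟨⟨-, hj⟩, hT₀, hT₁⟩ := hT
    have hij : j ≠ i := by rintro rfl; exact hj.ne' hi
    simp only [DTree.eval, Function.update_of_ne hij]
    rw [h₀ hT₀ (influence_restrict_eq_zero hi _ _), h₁ hT₁ (influence_restrict_eq_zero hi _ _)]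

/-- Restrictions still live on the whole cube. The error is nevertheless an average over the
children because the subtrees ignore `i`, whose influence is 0 below the root. -/
lemma QueriesInfluential.error_node {n : ℕ} {i : Fin n} {t₀ t₁ : DecisionTree n} {f : BoolFn n}
    (h₀ : QueriesInfluential (restrict f i false) t₀)
    (h₁ : QueriesInfluential (restrict f i true) t₁) :
    error (DTree.node i t₀ t₁).eval f =
      (error t₀.eval (restrict f i false) + error t₁.eval (restrict f i true)) / 2 := by
  rw [error_eq, error_eq, error_eq, pr_split i]
  congr 2
  · refine pr_congr fun x => ?_
    simp [DTree.eval, restrict, h₀.eval_update (influence_restrict_self _ _ _)]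
  · refine pr_congr fun x => ?_
    simp [DTree.eval, restrict, h₁.eval_update (influence_restrict_self _ _ _)]

lemma error_nonneg {n : ℕ} (f g : BoolFn n) : 0 ≤ error f g := by
  rw [error_eq]; exact pr_nonneg _

lemma eq_of_error_nonpos {n : ℕ} {f g : BoolFn n} (h : error f g ≤ 0) : f = g := by
  rw [error_eq] at h
  by_contra hne
  obtain ⟨x, hx⟩ := Function.ne_iff.1 hne
  exact (pr_pos (P := fun x => f x ≠ g x) hx).not_ge h

lemma error_self {n : ℕ} (f : BoolFn n) : error f f = 0 := by
  rw [error_eq]; exact pr_of_forall_not (by simp)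

lemma QueriesInfluential.completion {n : ℕ} {B : BareTree n} {f : BoolFn n}
    (h : QueriesInfluential f B) : QueriesInfluential f (completion f B) := by
  induction B generalizing f with
  | leaf a => trivial
  | node i t₀ t₁ h₀ h₁ => exact ⟨h.1, h₀ h.2.1, h₁ h.2.2⟩

lemma QueriesInfluential.pruning {n : ℕ} {α β : Type} {S : DTree n α} {T : DTree n β}
    (hST : IsPruning S T) {f : BoolFn n} (h : QueriesInfluential f T) :
    QueriesInfluential f S := by
  induction hST generalizing f with
  | leaf a T => trivial
  | node i s₀ s₁ t₀ t₁ _ _ ih₀ ih₁ => exact ⟨h.1, ih₀ h.2.1, ih₁ h.2.2⟩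

lemma DTree.size_pos {n : ℕ} {α : Type} (T : DTree n α) : 0 < T.size := by
  induction T with
  | leaf a => exact Nat.one_pos
  | node i t₀ t₁ h₀ h₁ => simp only [DTree.size]; omega

lemma QueriesInfluential.splitLeaf {n : ℕ} {B : BareTree n} {f : BoolFn n} {π : Path n} {i : Fin n}
    (h : QueriesInfluential f B) (hπ : π ∈ B.leafPaths)
    (hi : IsMostInfluential (restrictPath f π) i) (hpos : 0 < influence (restrictPath f π) i) :
    QueriesInfluential f (splitLeaf B π i) ∧ (splitLeaf B π i).size = B.size + 1 := by
  induction B generalizing f π with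
  | leaf a =>
    simp only [DTree.leafPaths, List.mem_singleton] at hπ
    subst hπ
    exact ⟨⟨⟨hi, hpos⟩, trivial, trivial⟩, rfl⟩
  | node j t₀ t₁ h₀ h₁ =>
    simp only [DTree.leafPaths, List.mem_append, List.mem_map] at hπ
    obtain ⟨π', hπ', rfl⟩ | ⟨π', hπ', rfl⟩ := hπ
    · obtain ⟨h2, h3⟩ := h₀ h.2.1 hπ' hi hpos
      exact ⟨⟨h.1, h2, h.2.2⟩, by simp only [TopDown.splitLeaf, DTree.size, h3]; omega⟩
    · obtain ⟨h2, h3⟩ := h₁ h.2.2 hπ' hi hpos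
      exact ⟨⟨h.1, h.2.1, h2⟩, by simp only [TopDown.splitLeaf, DTree.size, h3]; omega⟩

/-! ### The heuristic makes progress and stops -/

lemma exists_const_of_influence_eq_zero {n : ℕ} {f : BoolFn n} (h : ∀ i, influence f i = 0) :
    ∃ a, ∀ x, f x = a := by
  have h' := fun i => influence_eq_zero_iff.1 (h i)
  have key : ∀ (s : Finset (Fin n)) (x y : Fin n → Bool), f (s.piecewise x y) = f y := by
    intro s
    induction s using Finset.induction_on with
    | empty => simp
    | insert a s ha ih =>
      intro x y
      rw [piecewise_insert, h', ih]
  exact ⟨f fun _ => false, fun x => by simpa using key univ x fun _ => false⟩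

lemma majority_const {n : ℕ} {f : BoolFn n} {a : ℤˣ} (h : ∀ x, f x = a) : majority f = a := by
  have hE : expectation f = ((a : ℤ) : ℝ) := by
    simp [expectation, h]
  unfold majority
  rw [hE]
  obtain rfl | rfl := Int.units_eq_one_or a <;> norm_num

/-- Where no variable has influence, the subfunction is constant and its majority label is correct.
So as long as there is an error, the maximal score is positive. -/
lemma exists_leaf_of_error_pos {n : ℕ} {B : BareTree n} {f : BoolFn n}
    (h : QueriesInfluential f B) (he : 0 < error (TopDown.completion f B).eval f) :
    ∃ π ∈ B.leafPaths, ∃ i, 0 < influence (restrictPath f π) i := by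
  induction B generalizing f with
  | leaf a =>
    refine ⟨[], by simp [DTree.leafPaths], ?_⟩
    by_contra! hc
    obtain ⟨a, ha⟩ := exists_const_of_influence_eq_zero
      fun i => le_antisymm (hc i) (influence_nonneg _ _)
    simp only [restrictPath] at ha
    rw [show (TopDown.completion f (.leaf _)).eval = f from
      funext fun x => by simp [TopDown.completion, DTree.eval, ha, majority_const ha],
      error_self] at he
    exact lt_irrefl _ he
  | node i t₀ t₁ h₀ h₁ =>
    rw [TopDown.completion, QueriesInfluential.error_node h.2.1.completion h.2.2.completion] at he
    by_cases h0 : 0 < error (TopDown.completion (restrict f i false) t₀).eval (restrict f i false)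
    · obtain ⟨π, hπ, j, hj⟩ := h₀ h.2.1 h0
      exact ⟨(i, false) :: π, by simp [DTree.leafPaths, hπ], j, hj⟩
    · have h1 : 0 < error (TopDown.completion (restrict f i true) t₁).eval (restrict f i true) := by
        linarith
      obtain ⟨π, hπ, j, hj⟩ := h₁ h.2.2 h1
      exact ⟨(i, true) :: π, by simp [DTree.leafPaths, hπ], j, hj⟩

lemma exists_isMostInfluential {n : ℕ} (f : BoolFn n) (j : Fin n) :
    ∃ i, IsMostInfluential f i := by
  obtain ⟨i, -, hi⟩ := exists_max_image univ (influence f) ⟨j, mem_univ _⟩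
  exact ⟨i, fun k => hi k (mem_univ _)⟩

lemma Reachable.queriesInfluential {n : ℕ} {f : BoolFn n} {ε : ℝ} (hε : 0 ≤ ε) {B : BareTree n}
    (hB : Reachable f ε B) : QueriesInfluential f B := by
  induction hB with
  | init => trivial
  | step B π i hB herr hπ hi hmax ih =>
    refine (ih.splitLeaf hπ hi ?_).1
    obtain ⟨π', hπ', j, hj⟩ := exists_leaf_of_error_pos ih (hε.trans_lt (not_le.1 herr))
    obtain ⟨i', hi'⟩ := exists_isMostInfluential (restrictPath f π') j
    have h1 := hmax π' hπ' i' hi'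
    have h2 : 0 < score f π' i' := mul_pos (by positivity) (hj.trans_le (hi' j))
    exact pos_of_mul_pos_right (h2.trans_le h1) (by positivity)

/-- A variable of positive influence is never queried twice on a path. This bounds the length of
every run. -/
lemma QueriesInfluential.size_le {n : ℕ} {α : Type} {T : DTree n α} {f : BoolFn n}
    (hT : QueriesInfluential f T) (s : Finset (Fin n)) (hs : ∀ i ∉ s, influence f i = 0) :
    T.size ≤ 2 ^ s.card := by
  induction T generalizing f s with
  | leaf a => exact Nat.one_le_two_pow
  | node i t₀ t₁ h₀ h₁ =>
    have hi : i ∈ s := by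
      by_contra hi
      exact hT.1.2.ne' (hs i hi)
    have key : ∀ b, ∀ j ∉ s.erase i, influence (restrict f i b) j = 0 := by
      intro b j hj
      by_cases hij : j = i
      · rw [hij]; exact influence_restrict_self _ _ _
      · exact influence_restrict_eq_zero (hs j fun h => hj (mem_erase.2 ⟨hij, h⟩)) _ _
    have a0 := h₀ hT.2.1 _ (key false)
    have a1 := h₁ hT.2.2 _ (key true)
    rw [← card_erase_add_one hi, pow_succ]
    simp only [DTree.size]
    omega

lemma Reachable.exists_step {n : ℕ} {f : BoolFn n} {ε : ℝ} (hε : 0 ≤ ε) {B : BareTree n}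
    (hB : Reachable f ε B) (herr : ¬ error (TopDown.completion f B).eval f ≤ ε) :
    ∃ B', Reachable f ε B' ∧ B'.size = B.size + 1 := by
  have hg := hB.queriesInfluential hε
  obtain ⟨π₀, hπ₀, j, -⟩ := exists_leaf_of_error_pos hg (hε.trans_lt (not_le.1 herr))
  choose m hm using fun π => exists_isMostInfluential (restrictPath f π) j
  obtain ⟨π, hπ, hmax⟩ := exists_max_image B.leafPaths.toFinset (fun π => score f π (m π))
    ⟨π₀, by simpa using hπ₀⟩
  have hπ' : π ∈ B.leafPaths := by simpa using hπ
  have hmax' : ∀ π' ∈ B.leafPaths, ∀ i' : Fin n,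
      IsMostInfluential (restrictPath f π') i' → score f π' i' ≤ score f π (m π) := by
    intro π' hπ1 i' _
    refine le_trans ?_ (hmax π' (by simpa using hπ1))
    exact mul_le_mul_of_nonneg_left (hm π' i') (by positivity)
  have hB' := Reachable.step B π (m π) hB herr hπ' (hm π) hmax'
  refine ⟨_, hB', (hg.splitLeaf hπ' (hm π) ?_).2⟩
  obtain ⟨π', hπ', j', hj⟩ := exists_leaf_of_error_pos hg (hε.trans_lt (not_le.1 herr))
  have h1 := hmax' π' hπ' _ (hm π')
  have h2 : 0 < score f π' (m π') := mul_pos (by positivity) (hj.trans_le (hm π' j'))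
  exact pos_of_mul_pos_right (h2.trans_le h1) (by positivity)

/-- Without this the `sInf` in `topDownDTSize` could be that of the empty set, which is 0. -/
lemma exists_isTopDownOutput {n : ℕ} (f : BoolFn n) {ε : ℝ} (hε : 0 ≤ ε) :
    ∃ T, IsTopDownOutput f ε T := by
  by_contra hc
  have hrun : ∀ B, Reachable f ε B → ¬ error (TopDown.completion f B).eval f ≤ ε :=
    fun B hB herr => hc ⟨_, B, hB, herr, rfl⟩
  have key : ∀ k : ℕ, ∃ B, Reachable f ε B ∧ B.size = k + 1 := by
    intro k
    induction k with
    | zero => exact ⟨_, .init, rfl⟩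
    | succ k ih =>
      obtain ⟨B, hB, hk⟩ := ih
      rw [← hk]
      exact hB.exists_step hε (hrun B hB)
  obtain ⟨B, hB, hk⟩ := key (2 ^ n)
  have := (hB.queriesInfluential hε).size_le univ (by simp)
  rw [card_univ, Fintype.card_fin] at this
  omega

lemma IsTopDownOutput.queriesInfluential {n : ℕ} {f : BoolFn n} {ε : ℝ} (hε : 0 ≤ ε)
    {T : DecisionTree n} (hT : IsTopDownOutput f ε T) :
    QueriesInfluential f T ∧ error T.eval f ≤ ε := by
  obtain ⟨B, hB, he, rfl⟩ := hT
  exact ⟨(hB.queriesInfluential hε).completion, he⟩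

lemma exists_size_eq_topDownDTSize {n : ℕ} (f : BoolFn n) {ε : ℝ} (hε : 0 ≤ ε) :
    ∃ T : DecisionTree n, QueriesInfluential f T ∧ error T.eval f ≤ ε ∧
      T.size = topDownDTSize f ε := by
  obtain ⟨T₀, h₀⟩ := exists_isTopDownOutput f hε
  have := Nat.sInf_mem (s := {s | ∃ T : DecisionTree n, IsTopDownOutput f ε T ∧ T.size = s})
    ⟨_, T₀, h₀, rfl⟩
  obtain ⟨T, hT, hs⟩ := this
  exact ⟨T, (hT.queriesInfluential hε).1, (hT.queriesInfluential hε).2, hs⟩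

/-! ### Decision tree size -/

lemma dtSize_le {n : ℕ} {f : BoolFn n} (T : DecisionTree n) (h : T.eval = f) :
    dtSize f ≤ T.size := Nat.sInf_le ⟨T, h, rfl⟩

lemma exists_size_eq_dtSize {n : ℕ} (f : BoolFn n) :
    ∃ T : DecisionTree n, T.eval = f ∧ T.size = dtSize f := by
  obtain ⟨T, hT⟩ := exists_isTopDownOutput f le_rfl
  exact Nat.sInf_mem (s := {s | ∃ T : DecisionTree n, T.eval = f ∧ T.size = s})
    ⟨_, T, eq_of_error_nonpos (hT.queriesInfluential le_rfl).2, rfl⟩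

lemma dtSize_pos {n : ℕ} (f : BoolFn n) : 0 < dtSize f := by
  obtain ⟨T, -, h⟩ := exists_size_eq_dtSize f
  rw [← h]
  exact T.size_pos

lemma dtSize_const {n : ℕ} {f : BoolFn n} {a : ℤˣ} (h : ∀ x, f x = a) : dtSize f = 1 :=
  le_antisymm (dtSize_le (.leaf a) (funext fun x => (h x).symm)) (dtSize_pos f)

lemma exists_tree_restrict {n : ℕ} {α : Type} (T : DTree n α) (i : Fin n) (b : Bool) :
    ∃ T' : DTree n α, (∀ x, T'.eval x = T.eval (Function.update x i b)) ∧ T'.size ≤ T.size := by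
  induction T with
  | leaf a => exact ⟨.leaf a, fun _ => rfl, le_rfl⟩
  | node j t₀ t₁ h₀ h₁ =>
    obtain ⟨s₀, e₀, l₀⟩ := h₀
    obtain ⟨s₁, e₁, l₁⟩ := h₁
    by_cases hj : j = i
    · subst hj
      cases b
      · exact ⟨s₀, fun x => by simp [e₀, DTree.eval], by simp only [DTree.size]; omega⟩
      · exact ⟨s₁, fun x => by simp [e₁, DTree.eval], by simp only [DTree.size]; omega⟩
    · exact ⟨.node j s₀ s₁, fun x => by simp [e₀, e₁, DTree.eval, hj],
        by simp only [DTree.size]; omega⟩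

lemma dtSize_restrict_le_of_eval {n : ℕ} {f : BoolFn n} {i : Fin n} {b : Bool}
    (T : DecisionTree n) (h : ∀ x, T.eval (Function.update x i b) = restrict f i b x) :
    dtSize (restrict f i b) ≤ T.size := by
  obtain ⟨T', e, l⟩ := exists_tree_restrict T i b
  exact (dtSize_le T' (funext fun x => (e x).trans (h x))).trans l

lemma const_or_exists_dtSize_restrict_add_le {n : ℕ} (f : BoolFn n) :
    (∃ a, ∀ x, f x = a) ∨
      ∃ i, dtSize (restrict f i false) + dtSize (restrict f i true) ≤ dtSize f := by
  obtain ⟨T, hT, hs⟩ := exists_size_eq_dtSize f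
  cases T with
  | leaf a => exact Or.inl ⟨a, fun x => by rw [← hT]; rfl⟩
  | node i t₀ t₁ =>
    refine Or.inr ⟨i, ?_⟩
    rw [← hs]
    refine Nat.add_le_add (dtSize_restrict_le_of_eval t₀ fun x => ?_)
      (dtSize_restrict_le_of_eval t₁ fun x => ?_) <;> simp [restrict, ← hT, DTree.eval]

/-- Strong induction on the decision tree size. -/
lemma dtSize_induction {n : ℕ} {p : BoolFn n → Prop} (const : ∀ f a, (∀ x, f x = a) → p f)
    (step : ∀ f i, dtSize (restrict f i false) + dtSize (restrict f i true) ≤ dtSize f →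
      p (restrict f i false) → p (restrict f i true) → p f) (f : BoolFn n) : p f := by
  induction hd : dtSize f using Nat.strong_induction_on generalizing f with
  | _ d ih =>
    obtain ⟨a, ha⟩ | ⟨i, hi⟩ := const_or_exists_dtSize_restrict_add_le f
    · exact const f a ha
    · have h0 := dtSize_pos (restrict f i false)
      have h1 := dtSize_pos (restrict f i true)
      exact step f i hi (ih _ (by omega) _ rfl) (ih _ (by omega) _ rfl)

lemma restrict_eq_self {n : ℕ} {f : BoolFn n} {i : Fin n} (h : influence f i = 0) (b : Bool) :
    restrict f i b = f := funext fun x => influence_eq_zero_iff.1 h x b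

/-- The function that agrees with `g` where the variable `i` is `1` and with `h` elsewhere. -/
def mux {n : ℕ} (i : Fin n) (g h : BoolFn n) : BoolFn n := fun x => if x i then g x else h x

lemma dtSize_mux_le {n : ℕ} (i : Fin n) (g h : BoolFn n) :
    dtSize (mux i g h) ≤ dtSize g + dtSize h := by
  obtain ⟨T, hT, hs⟩ := exists_size_eq_dtSize g
  obtain ⟨S, hS, hs'⟩ := exists_size_eq_dtSize h
  refine (dtSize_le (.node i S T) ?_).trans ?_
  · funext x
    simp [DTree.eval, mux, hT, hS]
  · simp only [DTree.size]; omega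

lemma mux_restrict {n : ℕ} (f : BoolFn n) (i : Fin n) :
    mux i (restrict f i true) (restrict f i false) = f := by
  funext x
  unfold mux restrict
  split_ifs with h
  · rw [← h, Function.update_eq_self]
  · rw [← eq_false_of_ne_true h, Function.update_eq_self]

lemma dtSize_le_restrict_add {n : ℕ} (f : BoolFn n) (i : Fin n) :
    dtSize f ≤ dtSize (restrict f i true) + dtSize (restrict f i false) := by
  conv_lhs => rw [← mux_restrict f i]
  exact dtSize_mux_le _ _ _

lemma restrict_mux_of_ne {n : ℕ} {i j : Fin n} (hij : i ≠ j) (g h : BoolFn n) (b : Bool) :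
    restrict (mux i g h) j b = mux i (restrict g j b) (restrict h j b) := by
  funext x
  simp [restrict, mux, hij]

lemma restrict_mux_true {n : ℕ} {i : Fin n} {g h : BoolFn n} (hg : influence g i = 0) :
    restrict (mux i g h) i true = g := by
  funext x
  simp [restrict, mux, influence_eq_zero_iff.1 hg]

lemma restrict_mux_false {n : ℕ} {i : Fin n} {g h : BoolFn n} (hh : influence h i = 0) :
    restrict (mux i g h) i false = h := by
  funext x
  simp [restrict, mux, influence_eq_zero_iff.1 hh]

lemma eq_const_of_restrict {n : ℕ} {f : BoolFn n} {i : Fin n} {a : ℤˣ}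
    (h : ∀ b x, restrict f i b x = a) : ∀ x, f x = a := by
  intro x
  simpa [restrict] using h (x i) x

/-- Induction along an optimal tree of the mux. A root other than `i` is irrelevant to `g` or to
`h`, so both branches still have to contain that function in full. A loss can only occur where both
functions become the same constant; `hne` excludes this globally. -/
lemma dtSize_add_le_dtSize_mux {n : ℕ} {i : Fin n} (F g h : BoolFn n) (hF : F = mux i g h)
    (hg : influence g i = 0) (hh : influence h i = 0)
    (hdisj : ∀ j, influence g j = 0 ∨ influence h j = 0)
    (hne : ¬ ∃ a, (∀ x, g x = a) ∧ ∀ x, h x = a) :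
    dtSize g + dtSize h ≤ dtSize F := by
  induction F using dtSize_induction generalizing g h with
  | const F a ha =>
    refine absurd ⟨a, fun x => ?_, fun x => ?_⟩ hne
    · rw [← restrict_mux_true (h := h) hg, ← hF]; exact ha _
    · rw [← restrict_mux_false (g := g) hh, ← hF]; exact ha _
  | step F j hj ih₀ ih₁ =>
    by_cases hij : i = j
    · subst hij
      subst hF
      rw [restrict_mux_true hg, restrict_mux_false hh] at hj
      omega
    subst hF
    have hz : ∀ b (f : BoolFn n) k, influence f k = 0 → influence (restrict f j b) k = 0 :=
      fun b f k hf => influence_restrict_eq_zero hf j b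
    have key : ∀ b, (∃ a, (∀ x, restrict g j b x = a) ∧ ∀ x, restrict h j b x = a) ∨
        dtSize (restrict g j b) + dtSize (restrict h j b) ≤
          dtSize (restrict (mux i g h) j b) := by
      intro b
      by_cases hc : ∃ a, (∀ x, restrict g j b x = a) ∧ ∀ x, restrict h j b x = a
      · exact Or.inl hc
      · right
        cases b
        · exact ih₀ _ _ (restrict_mux_of_ne hij _ _ _) (hz _ _ _ hg) (hz _ _ _ hh)
            (fun k => (hdisj k).imp (hz _ _ _) (hz _ _ _)) hc
        · exact ih₁ _ _ (restrict_mux_of_ne hij _ _ _) (hz _ _ _ hg) (hz _ _ _ hh)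
            (fun k => (hdisj k).imp (hz _ _ _) (hz _ _ _)) hc
    have hp : ∀ b, 0 < dtSize (restrict (mux i g h) j b) := fun b => dtSize_pos _
    have hgs := dtSize_le_restrict_add g j
    have hhs := dtSize_le_restrict_add h j
    have hp0 := hp false
    have hp1 := hp true
    have hg1 := dtSize_pos g
    have hh1 := dtSize_pos h
    -- At most one branch collapses to a common constant. Then the function that ignores `j` has
    -- size 1, and the leaf of the collapsed branch pays for the missing unit.
    obtain ⟨a, ga, ha⟩ | k0 := key false
    · obtain ⟨a', ga', ha'⟩ | k1 := key true
      · exfalso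
        have haa : a' = a := by
          obtain hd | hd := hdisj j
          · rw [restrict_eq_self hd] at ga ga'
            rw [← ga fun _ => false, ← ga' fun _ => false]
          · rw [restrict_eq_self hd] at ha ha'
            rw [← ha fun _ => false, ← ha' fun _ => false]
        subst haa
        exact hne ⟨a', eq_const_of_restrict (i := j) (by rintro (_ | _) <;> assumption),
          eq_const_of_restrict (i := j) (by rintro (_ | _) <;> assumption)⟩
      · have e1 := dtSize_const ga
        have e2 := dtSize_const ha
        obtain hd | hd := hdisj j
        · rw [restrict_eq_self hd] at k1 e1
          omega
        · rw [restrict_eq_self hd] at k1 e2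
          omega
    · obtain ⟨a', ga', ha'⟩ | k1 := key true
      · have e1 := dtSize_const ga'
        have e2 := dtSize_const ha'
        obtain hd | hd := hdisj j
        · rw [restrict_eq_self hd] at k0 e1
          omega
        · rw [restrict_eq_self hd] at k0 e2
          omega
      · omega

lemma dtSize_mux {n : ℕ} {i : Fin n} {g h : BoolFn n}
    (hg : influence g i = 0) (hh : influence h i = 0)
    (hdisj : ∀ j, influence g j = 0 ∨ influence h j = 0)
    (hne : ¬ ∃ a, (∀ x, g x = a) ∧ ∀ x, h x = a) :
    dtSize (mux i g h) = dtSize g + dtSize h :=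
  le_antisymm (dtSize_mux_le _ _ _) (dtSize_add_le_dtSize_mux _ g h rfl hg hh hdisj hne)

lemma dtSize_neg_le {n : ℕ} (f : BoolFn n) : dtSize (fun x => -f x) ≤ dtSize f := by
  have key : ∀ T : DecisionTree n, ∃ S : DecisionTree n, (∀ x, S.eval x = -T.eval x) ∧
      S.size = T.size := by
    intro T
    induction T with
    | leaf a => exact ⟨.leaf (-a), fun _ => rfl, rfl⟩
    | node i t₀ t₁ h₀ h₁ =>
      obtain ⟨s₀, e₀, l₀⟩ := h₀
      obtain ⟨s₁, e₁, l₁⟩ := h₁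
      refine ⟨.node i s₀ s₁, fun x => ?_, by simp only [DTree.size, l₀, l₁]⟩
      simp only [DTree.eval, e₀, e₁]
      split_ifs <;> rfl
  obtain ⟨T, hT, hs⟩ := exists_size_eq_dtSize f
  obtain ⟨S, hS, hl⟩ := key T
  rw [← hs, ← hl]
  exact dtSize_le S (funext fun x => by rw [hS, hT])

lemma dtSize_neg {n : ℕ} (f : BoolFn n) : dtSize (fun x => -f x) = dtSize f :=
  le_antisymm (dtSize_neg_le f) (by simpa using dtSize_neg_le fun x => -f x)

lemma influence_neg {n : ℕ} (f : BoolFn n) (i : Fin n) :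
    influence (fun x => -f x) i = influence f i := by
  rw [influence_eq, influence_eq]
  exact pr_congr fun x => by simp

/-- The exclusive or with a fresh variable doubles the size: below a root other than `i` the
function keeps this form, and the sizes of the two restrictions of `g` add up to at least that of
`g`. -/
lemma two_mul_dtSize_le_dtSize_mux_neg {n : ℕ} {i : Fin n} (F g : BoolFn n)
    (hF : F = mux i (fun x => -g x) g) (hg : influence g i = 0) :
    2 * dtSize g ≤ dtSize F := by
  induction F using dtSize_induction generalizing g with
  | const F a ha =>
    exfalso
    have h1 := ha fun _ => true
    have h2 := ha (Function.update (fun _ => true) i false)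
    rw [hF] at h1 h2
    simp only [mux, if_true, Function.update_self, Bool.false_eq_true, if_false,
      influence_eq_zero_iff.1 hg] at h1 h2
    rw [← h2] at h1
    obtain h | h := Int.units_eq_one_or (g fun _ => true) <;> rw [h] at h1 <;> exact absurd h1 (by decide)
  | step F j hj ih₀ ih₁ =>
    subst hF
    by_cases hij : i = j
    · subst hij
      rw [restrict_mux_true (by rw [influence_neg]; exact hg), restrict_mux_false hg,
        dtSize_neg] at hj
      omega
    · have h0 := ih₀ (restrict g j false) (restrict_mux_of_ne hij _ _ _)
        (influence_restrict_eq_zero hg _ _)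
      have h1 := ih₁ (restrict g j true) (restrict_mux_of_ne hij _ _ _)
        (influence_restrict_eq_zero hg _ _)
      have := dtSize_le_restrict_add g j
      omega

lemma dtSize_mux_neg {n : ℕ} {i : Fin n} {g : BoolFn n} (hg : influence g i = 0) :
    dtSize (mux i (fun x => -g x) g) = 2 * dtSize g := by
  refine le_antisymm ((dtSize_mux_le _ _ _).trans ?_) (two_mul_dtSize_le_dtSize_mux_neg _ g rfl hg)
  rw [dtSize_neg]
  omega

lemma influence_mux_eq_zero {n : ℕ} {i j : Fin n} (hij : i ≠ j) {g h : BoolFn n}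
    (hg : influence g j = 0) (hh : influence h j = 0) : influence (mux i g h) j = 0 := by
  rw [influence_eq_zero_iff] at *
  intro x b
  simp [mux, hij, hg, hh]

lemma influence_const {n : ℕ} {f : BoolFn n} {a : ℤˣ} (h : ∀ x, f x = a) (i : Fin n) :
    influence f i = 0 := influence_eq_zero_iff.2 fun x b => by rw [h, h]

/-- Every positive number is the decision tree size of a function of few variables. -/
lemma exists_dtSize_eq {n : ℕ} (R : ℕ) (hR : 1 ≤ R) (W : Finset (Fin n))
    (hW : 2 * Nat.log 2 R ≤ W.card) :
    ∃ g : BoolFn n, (∀ i ∉ W, influence g i = 0) ∧ dtSize g = R := by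
  induction R using Nat.strong_induction_on generalizing W with
  | _ R ih =>
    obtain rfl | h2 := hR.eq_or_lt
    · exact ⟨fun _ => 1, fun i _ => influence_const (fun _ => rfl) i, dtSize_const fun _ => rfl⟩
    have hlog : Nat.log 2 R = Nat.log 2 (R / 2) + 1 := Nat.log_of_one_lt_of_le (by norm_num) h2
    obtain ⟨u, hu⟩ : W.Nonempty := card_pos.1 (by omega)
    have hc := card_erase_add_one hu
    obtain ⟨z, hz⟩ : (W.erase u).Nonempty := card_pos.1 (by omega)
    have hc' := card_erase_add_one hz
    obtain ⟨g, hg, hgR⟩ := ih (R / 2) (by omega) (by omega) ((W.erase u).erase z) (by omega)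
    have hgu : influence g u = 0 := hg u (by simp)
    have hgz : influence g z = 0 := hg z (by simp)
    have hgW : ∀ i ∉ W, influence g i = 0 := fun i hi =>
      hg i fun h => hi (mem_of_mem_erase (mem_of_mem_erase h))
    have huz : u ≠ z := (ne_of_mem_erase hz).symm
    -- Binary digits of `R`: the exclusive or with `u` doubles the size, and switching by `z` to a
    -- constant adds one. Each digit uses up two variables of `W`.
    set k := mux u (fun x => -g x) g with hk
    have hkR : dtSize k = 2 * (R / 2) := by rw [hk, dtSize_mux_neg hgu, hgR]
    have hkW : ∀ i ∉ W, influence k i = 0 := fun i hi =>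
      influence_mux_eq_zero (by rintro rfl; exact hi hu) (by rw [influence_neg]; exact hgW i hi)
        (hgW i hi)
    have hkz : influence k z = 0 := influence_mux_eq_zero huz (by rw [influence_neg]; exact hgz) hgz
    obtain hpar | hpar := Nat.even_or_odd' R |>.choose_spec
    · exact ⟨k, hkW, by omega⟩
    · have hone : dtSize (fun _ => 1 : BoolFn n) = 1 := dtSize_const fun _ => rfl
      have hi1 : ∀ i, influence (fun _ => 1 : BoolFn n) i = 0 := influence_const fun _ => rfl
      refine ⟨mux z k fun _ => 1, fun i hi => influence_mux_eq_zero ?_ (hkW i hi) (hi1 i), ?_⟩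
      · rintro rfl
        exact hi (mem_of_mem_erase hz)
      · rw [dtSize_mux hkz (hi1 z) (fun j => Or.inr (hi1 j)), hkR, hone]
        · omega
        · rintro ⟨a, ha, -⟩
          rw [dtSize_const ha] at hkR
          omega

lemma dtSize_le_two_pow_mul {n : ℕ} (A : Finset (Fin n)) (M : ℕ) (f : BoolFn n)
    (h : ∀ v, dtSize (fun x => f (A.piecewise v x)) ≤ M) : dtSize f ≤ 2 ^ A.card * M := by
  induction A using Finset.induction_on generalizing f with
  | empty => simpa using h fun _ => false
  | insert i A hi ih =>
    have key : ∀ b, dtSize (restrict f i b) ≤ 2 ^ A.card * M := by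
      intro b
      refine ih _ fun v => ?_
      have := h (Function.update v i b)
      convert this using 3 with x
      simp only [restrict]
      congr 1
      ext j
      by_cases hj : j = i
      · subst hj; simp
      · by_cases hjA : j ∈ A <;> simp [hj, hjA]
    rw [card_insert_of_notMem hi, pow_succ, mul_right_comm]
    have := dtSize_le_restrict_add f i
    have := key false
    have := key true
    omega

lemma dtSize_le_two_pow {n : ℕ} (A : Finset (Fin n)) (f : BoolFn n)
    (h : DependsOn f A) : dtSize f ≤ 2 ^ A.card := by
  rw [← mul_one (2 ^ A.card)]
  refine dtSize_le_two_pow_mul A 1 f fun v => ?_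
  refine (dtSize_const (a := f v) fun x => h fun i hi => ?_).le
  exact piecewise_eq_of_mem _ _ _ hi

-- The root accounts for one variable and the children for the others: a tree has one leaf more than
-- it has internal nodes.
open Classical in
lemma card_relevant_lt_dtSize {n : ℕ} (f : BoolFn n) :
    (univ.filter fun i => influence f i ≠ 0).card < dtSize f := by
  induction f using dtSize_induction with
  | const f a ha =>
    rw [filter_false_of_mem (by simp [influence_const ha])]
    simpa using dtSize_pos f
  | step f i hi ih₀ ih₁ =>
    have hsub : (univ.filter fun j => influence f j ≠ 0) ⊆
        {i} ∪ ((univ.filter fun j => influence (restrict f i false) j ≠ 0) ∪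
          (univ.filter fun j => influence (restrict f i true) j ≠ 0)) := by
      intro j hj
      simp only [mem_filter, mem_univ, true_and, mem_union, mem_singleton] at hj ⊢
      by_contra! hc
      apply hj
      rw [← mux_restrict f i]
      exact influence_mux_eq_zero (Ne.symm hc.1) hc.2.2 hc.2.1
    have h1 := card_le_card hsub
    have h2 := card_union_le {i} ((univ.filter fun j => influence (restrict f i false) j ≠ 0) ∪
          (univ.filter fun j => influence (restrict f i true) j ≠ 0))
    have h3 := card_union_le (univ.filter fun j => influence (restrict f i false) j ≠ 0)
          (univ.filter fun j => influence (restrict f i true) j ≠ 0)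
    rw [card_singleton] at h2
    omega

lemma pr_subcube_comp {n : ℕ} {κ : Type*} {e : κ → Fin n}
    (he : Function.Injective e) (s : Finset κ) (c : κ → Bool) :
    pr (fun x => ∀ k ∈ s, x (e k) = c k) = (1 / 2) ^ s.card := by
  rw [← card_map ⟨e, he⟩, ← pr_subcube _ (Function.extend e c fun _ => false)]
  refine pr_congr fun x => ?_
  simp [he.extend_apply]

/-! ### Exact representation: a function of linear decision tree size -/

/-- The names of the variables: three for the choice between two chains, `r` for each of the
chains, and two for each of `r` pairs. -/
abbrev ChainVar (r : ℕ) : Type := Fin 3 ⊕ (Bool × Fin r) ⊕ (Fin r × Bool)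

/-- The majority of three bits. -/
def majBit (x : Fin 3 → Bool) : Bool := (x 0 && x 1) || (x 0 && x 2) || (x 1 && x 2)

/-- The first `0` of the chain `a` is at some `i ≥ j`, and the `i`-th pair of variables is
`(1, 1)`, where for `i = j` only the variables in `K` are taken into account. -/
def ChainTrue {n r : ℕ} (e : ChainVar r → Fin n) (j : ℕ) (K : Finset Bool) (a : Bool)
    (x : Fin n → Bool) : Prop :=
  ∃ i : Fin r, j ≤ i ∧ (∀ i' < i, x (e (.inr (.inl (a, i')))) = true) ∧
    x (e (.inr (.inl (a, i)))) = false ∧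
    ∀ k, ((i : ℕ) = j → k ∈ K) → x (e (.inr (.inr (i, k)))) = true

/-- The chain that the three choice variables select. -/
def chosenChain {n r : ℕ} (e : ChainVar r → Fin n) (x : Fin n → Bool) : Bool :=
  majBit fun l => x (e (.inl l))

/-- The truth value of the chosen chain. -/
noncomputable def chainFn {n r : ℕ} (e : ChainVar r → Fin n) (j : ℕ) (K : Finset Bool) :
    BoolFn n :=
  open Classical in fun x => if ChainTrue e j K (chosenChain e x) x then 1 else -1

lemma chainFn_ne_iff {n r : ℕ} {e : ChainVar r → Fin n} {j : ℕ} {K : Finset Bool}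
    {x y : Fin n → Bool} : chainFn e j K x ≠ chainFn e j K y ↔
      ¬ (ChainTrue e j K (chosenChain e x) x ↔ ChainTrue e j K (chosenChain e y) y) := by
  unfold chainFn
  split_ifs with h1 h2 h2 <;> simp [h1, h2]

/-- The first `0` of the chain `a` is at `i`, and the variables of the `i`-th pair with index in
`K` are `1`. -/
def ChainCube {n r : ℕ} (e : ChainVar r → Fin n) (i : Fin r) (K : Finset Bool) (a : Bool)
    (x : Fin n → Bool) : Prop :=
  (∀ i' < i, x (e (.inr (.inl (a, i')))) = true) ∧ x (e (.inr (.inl (a, i)))) = false ∧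
    ∀ k ∈ K, x (e (.inr (.inr (i, k)))) = true

section chain

variable {n r : ℕ} {e : ChainVar r → Fin n} (he : Function.Injective e)

include he in
lemma pr_chainCube (i : Fin r) (K : Finset Bool) (a : Bool) :
    pr (ChainCube e i K a) = (1 / 2) ^ ((i : ℕ) + 1 + K.card) := by
  have h := pr_subcube_comp he
    ((∅ : Finset (Fin 3)).disjSum ((({a} : Finset Bool) ×ˢ Iic i).disjSum
      (({i} : Finset (Fin r)) ×ˢ K)))
    (Sum.elim (fun _ => true) (Sum.elim (fun p => decide (p.2 < i)) fun _ => true))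
  simp only [card_disjSum, card_product, card_empty, card_singleton, one_mul, zero_add,
    Fin.card_Iic] at h
  rw [← h]
  refine pr_congr fun x => ?_
  unfold ChainCube
  constructor
  · rintro ⟨h1, h2, h3⟩ (k | ⟨a', k⟩ | ⟨i', k⟩) hk
    · simp at hk
    · simp only [inr_mem_disjSum, inl_mem_disjSum, mem_product, mem_singleton, mem_Iic] at hk
      obtain ⟨rfl, hk⟩ := hk
      obtain hk | rfl := hk.lt_or_eq
      · simp [h1 k hk, hk]
      · simp [h2]
    · simp only [inr_mem_disjSum, mem_product, mem_singleton] at hk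
      obtain ⟨rfl, hk⟩ := hk
      simp [h3 k hk]
  · intro h
    refine ⟨fun i' hi' => ?_, ?_, fun k hk => ?_⟩
    · simpa [hi'] using h (.inr (.inl (a, i'))) (by simp [hi'.le])
    · simpa using h (.inr (.inl (a, i))) (by simp)
    · simpa using h (.inr (.inr (i, k))) (by simp [hk])

lemma chainTrue_iff_exists {j : ℕ} {K : Finset Bool} {a : Bool} {x : Fin n → Bool} :
    ChainTrue e j K a x ↔
      ∃ i : Fin r, j ≤ i ∧ ChainCube e i (if (i : ℕ) = j then K else univ) a x := by
  unfold ChainTrue ChainCube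
  refine exists_congr fun i => and_congr_right fun _ => and_congr_right fun _ =>
    and_congr_right fun _ => ?_
  split_ifs with h <;> simp [h]

lemma sum_half_pow_lt (j r : ℕ) : ∑ i ∈ Ico j r, (1 / 2 : ℝ) ^ (i + 1) < (1 / 2) ^ j := by
  obtain h | h := le_total r j
  · rw [Ico_eq_empty (by omega)]; simp
  · have : ∑ i ∈ Ico j r, (1 / 2 : ℝ) ^ (i + 1) = (1 / 2) ^ j - (1 / 2) ^ r := by
      induction r, h using Nat.le_induction with
      | base => simp
      | succ r h ih =>
        rw [sum_Ico_succ_top h, ih]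
        ring
    rw [this]
    have : (0 : ℝ) < (1 / 2) ^ r := by positivity
    linarith

-- The first 0 is at `i` with probability `(1/2) ^ (i + 1)`, these sum over `i ≥ j` to less than
-- `(1/2) ^ j`, and at each `i` at least the bits in `K` must be 1. The strict inequality is what
-- makes the pair variables win against the choice and chain variables.
include he in
lemma pr_chainTrue_lt (j : ℕ) (K : Finset Bool) (a : Bool) :
    pr (ChainTrue e j K a) < (1 / 2) ^ (j + K.card) := by
  have h1 : pr (ChainTrue e j K a) ≤ pr (fun x => ∃ i ∈ univ.filter (fun i : Fin r => j ≤ i),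
      ChainCube e i K a x) := by
    refine pr_mono fun x hx => ?_
    obtain ⟨i, hi, h1, h2, h3⟩ := chainTrue_iff_exists.1 hx
    exact ⟨i, by simpa using hi, h1, h2, fun k hk => h3 k (by split_ifs <;> simp [hk])⟩
  refine (h1.trans (pr_exists_le _ _)).trans_lt ?_
  simp_rw [pr_chainCube he, pow_add _ _ K.card]
  rw [← sum_mul]
  refine mul_lt_mul_of_pos_right (lt_of_le_of_lt ?_ (sum_half_pow_lt j r)) (by positivity)
  refine (sum_map (univ.filter fun i : Fin r => j ≤ i) Fin.valEmbedding
    (fun i : ℕ => (1 / 2 : ℝ) ^ (i + 1))).symm.trans_le ?_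
  refine sum_le_sum_of_subset_of_nonneg ?_ fun _ _ _ => by positivity
  intro i
  simp only [mem_map, mem_filter, mem_univ, true_and, Fin.valEmbedding_apply, mem_Ico]
  rintro ⟨i, hi, rfl⟩
  exact ⟨hi, i.2⟩

lemma dependsOn_chosenChain :
    DependsOn (chosenChain e) (Set.range fun l => e (.inl l)) := by
  intro x y h
  unfold chosenChain
  congr 1
  funext l
  exact h _ ⟨l, rfl⟩

include he in
lemma dependsOn_chainCube (i : Fin r) (K : Finset Bool) (a : Bool) :
    DependsOn (ChainCube e i K a) (Set.range fun l => e (.inl l))ᶜ := by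
  intro x y h
  have h' : ∀ p, x (e (.inr p)) = y (e (.inr p)) := fun p => h _ (by
    rintro ⟨l, hl⟩
    exact Sum.inl_ne_inr (he hl))
  simp only [ChainCube, h']

include he in
lemma dependsOn_chainTrue (j : ℕ) (K : Finset Bool) (a : Bool) :
    DependsOn (ChainTrue e j K a) (Set.range fun l => e (.inl l))ᶜ := by
  intro x y h
  have h' : ∀ p, x (e (.inr p)) = y (e (.inr p)) := fun p => h _ (by
    rintro ⟨l, hl⟩
    exact Sum.inl_ne_inr (he hl))
  simp only [ChainTrue, h']

include he in
lemma pr_chosenChain_eq (a : Bool) : pr (fun x => chosenChain e x = a) = 1 / 2 := by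
  have h := pr_comp_injective (he.comp Sum.inl_injective) (fun v : Fin 3 → Bool => majBit v = a)
  have hc : (univ.filter fun v : Fin 3 → Bool => majBit v = a).card = 4 := by
    cases a <;> decide
  simp only [Function.comp_apply] at h
  unfold chosenChain
  rw [h]
  have : ((univ.filter fun v : Fin 3 → Bool => majBit v = a).card : ℝ) = 4 := by exact_mod_cast hc
  rw [Fintype.card_fin]
  convert_to (4 : ℝ) / 2 ^ 3 = 1 / 2
  · rw [← this]
    congr!
  · norm_num

-- The choice is independent of the chains, so events of equal probability on both chains keep it on
-- the chosen one.
include he in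
lemma pr_chosenChain_and {E : Bool → (Fin n → Bool) → Prop} {p : ℝ}
    (hE : ∀ a, DependsOn (E a) (Set.range fun l => e (.inl l))ᶜ) (hp : ∀ a, pr (E a) = p) :
    pr (fun x => E (chosenChain e x) x) = p := by
  rw [← sum_pr_and_eq _ (chosenChain e)]
  have : ∀ a, pr (fun x => E (chosenChain e x) x ∧ chosenChain e x = a) = 1 / 2 * p := by
    intro a
    rw [← pr_chosenChain_eq he a, ← hp a, ← pr_and_of_dependsOn _ (hE a)]
    · refine pr_congr fun x => ⟨?_, ?_⟩
      · rintro ⟨h, rfl⟩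
        exact ⟨rfl, h⟩
      · rintro ⟨rfl, h⟩
        exact ⟨h, rfl⟩
    · intro x y h
      simp only [dependsOn_chosenChain h]
  simp_rw [this]
  simp

/-! ### Influences on the chain function -/

lemma flipAt_comp_of_ne {e : ChainVar r → Fin n} {x : Fin n → Bool} (he : Function.Injective e)
    {p q : ChainVar r} (h : p ≠ q) : flipAt x (e q) (e p) = x (e p) :=
  flipAt_of_ne x fun h' => h (he h')

include he in
lemma chosenChain_flipAt (x : Fin n → Bool) (p : (Bool × Fin r) ⊕ (Fin r × Bool)) :
    chosenChain e (flipAt x (e (.inr p))) = chosenChain e x := by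
  unfold chosenChain
  congr 1
  funext l
  exact flipAt_comp_of_ne he Sum.inl_ne_inr

-- Where the first 0 of the chosen chain is at `j` and the other bits of `K` are 1, the function is
-- the variable itself. No factor 1/2 is lost to the choice because the chains share the pairs.
include he in
lemma le_influence_chainFn {j : ℕ} (hj : j < r) {K : Finset Bool} {k : Bool} (hk : k ∈ K) :
    (1 / 2 : ℝ) ^ (j + K.card) ≤ influence (chainFn e j K) (e (.inr (.inr (⟨j, hj⟩, k)))) := by
  have h := pr_chosenChain_and he (E := ChainCube e ⟨j, hj⟩ (K.erase k))
    (dependsOn_chainCube he _ _) (pr_chainCube he _ _)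
  have hc := card_erase_add_one hk
  rw [show j + K.card = ((⟨j, hj⟩ : Fin r) : ℕ) + 1 + (K.erase k).card by simp only; omega, ← h,
    influence_eq]
  refine pr_mono fun x hx => ?_
  obtain ⟨h1, h2, h3⟩ := hx
  rw [chainFn_ne_iff, chosenChain_flipAt he]
  set a := chosenChain e x
  have key : ∀ y : Fin n → Bool, (∀ p, p ≠ .inr (.inr (⟨j, hj⟩, k)) → y (e p) = x (e p)) →
      (ChainTrue e j K a y ↔ y (e (.inr (.inr (⟨j, hj⟩, k)))) = true) := by
    intro y hy
    have hy1 : ∀ i, y (e (.inr (.inl (a, i)))) = x (e (.inr (.inl (a, i)))) := fun i =>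
      hy _ (by simp)
    constructor
    · rintro ⟨i, hi, h4, h5, h6⟩
      rw [hy1] at h5
      have hij : i = ⟨j, hj⟩ := by
        refine le_antisymm ?_ hi
        by_contra! hlt
        rw [← hy1, h4 _ hlt] at h2
        exact absurd h2 (by simp)
      subst hij
      exact h6 k fun _ => hk
    · intro hyk
      refine ⟨⟨j, hj⟩, le_rfl, fun i hi => by rw [hy1, h1 i hi], by rw [hy1, h2], fun k' hk' => ?_⟩
      by_cases hkk : k' = k
      · rw [hkk, hyk]
      · rw [hy _ (by simpa using hkk), h3 k' (mem_erase.2 ⟨hkk, hk' rfl⟩)]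
  rw [key x fun _ _ => rfl, key _ fun p hp => flipAt_comp_of_ne he hp, flipAt_same]
  cases x (e (.inr (.inr (⟨j, hj⟩, k)))) <;> simp

lemma majBit_eq_of_eq (l : Fin 3) : ∀ v w : Fin 3 → Bool, (∀ l', l' ≠ l → v l' = w l') →
    v (l + 1) = v (l + 2) → majBit v = majBit w := by
  revert l
  decide

-- The bit must be pivotal in the majority, which has probability 1/2, and some chain must be true.
-- The factor 1/2 compensates for the union bound over two chains; this is why one choice bit would
-- not do.
include he in
lemma influence_choice_lt (j : ℕ) (K : Finset Bool) (l : Fin 3) :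
    influence (chainFn e j K) (e (.inl l)) < (1 / 2) ^ (j + K.card) := by
  have hinv : ∀ a x, ChainTrue e j K a (flipAt x (e (.inl l))) = ChainTrue e j K a x := by
    intro a x
    refine dependsOn_chainTrue he j K a fun i hi => flipAt_of_ne x ?_
    rintro rfl
    exact hi ⟨l, rfl⟩
  have hdiff : pr (fun x : Fin n → Bool => x (e (.inl (l + 1))) ≠ x (e (.inl (l + 2)))) = 1 / 2 := by
    have h := pr_comp_injective (he.comp Sum.inl_injective)
      (fun v : Fin 3 → Bool => v (l + 1) ≠ v (l + 2))
    have hc : (univ.filter fun v : Fin 3 → Bool => v (l + 1) ≠ v (l + 2)).card = 4 := by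
      clear * - n
      revert l; decide
    simp only [Function.comp_apply] at h
    rw [h, Fintype.card_fin]
    have : ((univ.filter fun v : Fin 3 → Bool => v (l + 1) ≠ v (l + 2)).card : ℝ) = 4 := by
      exact_mod_cast hc
    convert_to (4 : ℝ) / 2 ^ 3 = 1 / 2
    · rw [← this]
      congr!
    · norm_num
  have h1 : influence (chainFn e j K) (e (.inl l)) ≤
      pr (fun x : Fin n → Bool => x (e (.inl (l + 1))) ≠ x (e (.inl (l + 2))) ∧
        (ChainTrue e j K false x ∨ ChainTrue e j K true x)) := by
    rw [influence_eq]
    refine pr_mono fun x hx => ?_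
    rw [chainFn_ne_iff, hinv] at hx
    constructor
    · intro heq
      have : chosenChain e (flipAt x (e (.inl l))) = chosenChain e x := by
        refine (majBit_eq_of_eq l _ _ (fun l' hl' => ?_) heq).symm
        exact (flipAt_comp_of_ne he (by simpa using hl')).symm
      rw [this] at hx
      exact hx Iff.rfl
    · by_contra! hc
      have : ∀ a, ¬ ChainTrue e j K a x := by rintro (_ | _) <;> tauto
      exact hx (iff_of_false (this _) (this _))
  refine h1.trans_lt ?_
  rw [pr_and_of_dependsOn (A := Set.range fun l => e (.inl l)), hdiff]
  · have := pr_or_le (ChainTrue e j K false) (ChainTrue e j K true)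
    have := pr_chainTrue_lt he j K false
    have := pr_chainTrue_lt he j K true
    linarith
  · intro x y h
    simp only [h (e (.inl (l + 1))) ⟨_, rfl⟩, h (e (.inl (l + 2))) ⟨_, rfl⟩]
  · intro x y h
    simp only [dependsOn_chainTrue he _ _ _ h]

-- The chain must be chosen, which has probability 1/2, and be true before or after the flip; these
-- last two events have the same probability.
include he in
lemma influence_chain_lt (j : ℕ) (K : Finset Bool) (a : Bool) (i : Fin r) :
    influence (chainFn e j K) (e (.inr (.inl (a, i)))) < (1 / 2) ^ (j + K.card) := by
  have h1 : influence (chainFn e j K) (e (.inr (.inl (a, i)))) ≤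
      pr (fun x : Fin n → Bool => chosenChain e x = a ∧
        (ChainTrue e j K a x ∨ ChainTrue e j K a (flipAt x (e (.inr (.inl (a, i))))))) := by
    rw [influence_eq]
    refine pr_mono fun x hx => ?_
    rw [chainFn_ne_iff, chosenChain_flipAt he] at hx
    by_cases ha : chosenChain e x = a
    · subst ha
      exact ⟨rfl, by tauto⟩
    · exfalso
      apply hx
      have h1 : ∀ i', flipAt x (e (.inr (.inl (a, i)))) (e (.inr (.inl (chosenChain e x, i')))) =
        x (e (.inr (.inl (chosenChain e x, i')))) := fun i' => flipAt_comp_of_ne he (by simp [ha])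
      have h2 : ∀ p, flipAt x (e (.inr (.inl (a, i)))) (e (.inr (.inr p))) =
        x (e (.inr (.inr p))) := fun i' => flipAt_comp_of_ne he (by simp)
      simp only [ChainTrue, h1, h2]
  refine h1.trans_lt ?_
  rw [pr_and_of_dependsOn (A := Set.range fun l => e (.inl l)), pr_chosenChain_eq he]
  · have := pr_or_le (ChainTrue e j K a)
      (fun x => ChainTrue e j K a (flipAt x (e (.inr (.inl (a, i))))))
    rw [pr_flipAt] at this
    have := pr_chainTrue_lt he j K a
    linarith
  · intro x y h
    simp only [dependsOn_chosenChain h]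
  · intro x y h
    have : ∀ i' ∈ (Set.range fun l => e (.inl l))ᶜ, flipAt x (e (.inr (.inl (a, i)))) i' =
        flipAt y (e (.inr (.inl (a, i)))) i' := by
      intro i' hi'
      by_cases hii : i' = e (.inr (.inl (a, i)))
      · subst hii
        rw [flipAt_same, flipAt_same, h _ hi']
      · rw [flipAt_of_ne _ hii, flipAt_of_ne _ hii, h _ hi']
    simp only [dependsOn_chainTrue he _ _ _ h, dependsOn_chainTrue he _ _ _ this]

-- For `i > j` the first 0 must be at `i` and the other bit of the pair must be 1, which has
-- probability `(1/2) ^ (i + 2)`, less than `(1/2) ^ (j + 2)`. In the other cases the variable has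
-- no influence.
include he in
lemma influence_pair_lt (j : ℕ) (K : Finset Bool) (i : Fin r) (k : Bool)
    (hik : (i : ℕ) = j → k ∉ K) :
    influence (chainFn e j K) (e (.inr (.inr (i, k)))) < (1 / 2) ^ (j + K.card) := by
  have hinv : ∀ (a : Bool) (x : Fin n → Bool), ¬ (j < i ∧ ChainCube e i {!k} a x) →
      (ChainTrue e j K a x → ChainTrue e j K a (flipAt x (e (.inr (.inr (i, k)))))) := by
    rintro a x hx ⟨i', hi', h1, h2, h3⟩
    have hfl : ∀ p, p ≠ .inr (.inr (i, k)) → flipAt x (e (.inr (.inr (i, k)))) (e p) = x (e p) :=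
      fun p hp => flipAt_comp_of_ne he hp
    refine ⟨i', hi', fun i'' hi'' => by rw [hfl _ (by simp), h1 i'' hi''],
      by rw [hfl _ (by simp), h2], fun k' hk' => ?_⟩
    rw [hfl, h3 k' hk']
    simp only [ne_eq, Sum.inr.injEq, Prod.mk.injEq, not_and]
    rintro rfl rfl
    obtain hlt | heq := hi'.lt_or_eq
    · exact hx ⟨hlt, h1, h2, fun k'' _ => h3 k'' fun h => absurd h hlt.ne'⟩
    · exact hik heq.symm (hk' heq.symm)
  by_cases hji : j < i
  · have h1 : influence (chainFn e j K) (e (.inr (.inr (i, k)))) ≤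
        pr (fun x => ChainCube e i {!k} (chosenChain e x) x) := by
      rw [influence_eq]
      refine pr_mono fun x hx => ?_
      by_contra hc
      rw [chainFn_ne_iff, chosenChain_flipAt he] at hx
      refine hx ⟨hinv _ _ fun h => hc h.2, fun h => ?_⟩
      have hback := hinv _ _ (fun h' => hc ?_) h
      · rwa [flipAt_flipAt] at hback
      obtain ⟨-, h4, h5, h6⟩ := h'
      have hfl : ∀ p, p ≠ .inr (.inr (i, k)) →
        flipAt x (e (.inr (.inr (i, k)))) (e p) = x (e p) := fun p hp => flipAt_comp_of_ne he hp
      refine ⟨fun i'' hi'' => ?_, ?_, fun k' hk' => ?_⟩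
      · rw [← hfl _ (by simp)]; exact h4 i'' hi''
      · rw [← hfl _ (by simp)]; exact h5
      · rw [← hfl _ ?_]
        · exact h6 k' hk'
        · rw [mem_singleton] at hk'
          subst hk'
          simp
    refine h1.trans_lt ?_
    rw [pr_chosenChain_and he (dependsOn_chainCube he _ _) (pr_chainCube he _ _), card_singleton]
    have hK : K.card ≤ 2 := card_le_univ K
    exact pow_lt_pow_right_of_lt_one₀ (by norm_num) (by norm_num) (by omega)
  · have : influence (chainFn e j K) (e (.inr (.inr (i, k)))) = 0 := by
      rw [influence_eq]
      refine pr_of_forall_not fun x => ?_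
      rw [chainFn_ne_iff, chosenChain_flipAt he, not_not]
      refine ⟨hinv _ _ fun h => hji h.1, fun h => ?_⟩
      have hback := hinv _ _ (fun h' => hji h'.1) h
      rwa [flipAt_flipAt] at hback
    rw [this]
    positivity

include he in
lemma exists_of_isMostInfluential_chainFn {j : ℕ} (hj : j < r) {K : Finset Bool}
    (hK : K.Nonempty) {i : Fin n} (hi : IsMostInfluential (chainFn e j K) i) :
    ∃ k ∈ K, i = e (.inr (.inr (⟨j, hj⟩, k))) := by
  obtain ⟨k, hk⟩ := hK
  have hle := (le_influence_chainFn he hj hk).trans (hi _)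
  by_cases hr : i ∈ Set.range e
  · obtain ⟨l | ⟨a, i⟩ | ⟨i, k'⟩, rfl⟩ := hr
    · exact absurd hle (influence_choice_lt he _ _ _).not_ge
    · exact absurd hle (influence_chain_lt he _ _ _ _).not_ge
    · by_cases h : (i : ℕ) = j ∧ k' ∈ K
      · obtain ⟨rfl, h⟩ := h
        exact ⟨k', h, rfl⟩
      · exact absurd hle (influence_pair_lt he _ _ _ _ fun h1 h2 => h ⟨h1, h2⟩).not_ge
  · exfalso
    have h0 : influence (chainFn e j K) i = 0 := by
      rw [influence_eq]
      refine pr_of_forall_not fun x => ?_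
      have : ∀ p, flipAt x i (e p) = x (e p) := fun p =>
        flipAt_of_ne x fun h => hr ⟨p, h⟩
      rw [chainFn_ne_iff, not_not]
      simp only [ChainTrue, chosenChain, this]
    rw [h0] at hle
    exact absurd hle (not_le.2 (by positivity))

/-! ### Greedy trees for the chain function -/

include he in
lemma restrict_chainFn_false {j : ℕ} (hj : j < r) {K : Finset Bool} {k : Bool} (hk : k ∈ K) :
    restrict (chainFn e j K) (e (.inr (.inr (⟨j, hj⟩, k)))) false =
      chainFn e (j + 1) univ := by
  funext x
  have hup : ∀ p, p ≠ .inr (.inr (⟨j, hj⟩, k)) →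
      Function.update x (e (.inr (.inr (⟨j, hj⟩, k)))) false (e p) = x (e p) := fun p hp =>
    Function.update_of_ne (fun h => hp (he h)) _ _
  have h0 : chosenChain e (Function.update x (e (.inr (.inr (⟨j, hj⟩, k)))) false) =
      chosenChain e x := by
    unfold chosenChain
    congr 1
    funext l
    exact hup _ (by simp)
  have key : ∀ a, ChainTrue e j K a (Function.update x (e (.inr (.inr (⟨j, hj⟩, k)))) false) ↔
      ChainTrue e (j + 1) univ a x := by
    intro a
    unfold ChainTrue
    refine exists_congr fun i => ?_
    have h1 : ∀ i' : Fin r, Function.update x (e (.inr (.inr (⟨j, hj⟩, k)))) false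
      (e (.inr (.inl (a, i')))) = x (e (.inr (.inl (a, i')))) := fun i' => hup _ (by simp)
    simp only [h1, mem_univ, implies_true, forall_const]
    constructor
    · rintro ⟨h2, h3, h4, h5⟩
      have hne : (i : ℕ) ≠ j := by
        intro h
        have hi : i = ⟨j, hj⟩ := Fin.ext h
        subst hi
        simpa using h5 k fun _ => hk
      refine ⟨by omega, h3, h4, fun k' => ?_⟩
      rw [← hup, h5 k' fun h => absurd h hne]
      simp only [ne_eq, Sum.inr.injEq, Prod.mk.injEq, not_and]
      rintro rfl
      exact absurd rfl hne
    · rintro ⟨h2, h3, h4, h5⟩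
      refine ⟨by omega, h3, h4, fun k' _ => ?_⟩
      rw [hup, h5 k']
      simp only [ne_eq, Sum.inr.injEq, Prod.mk.injEq, not_and]
      rintro rfl
      simp at h2
  unfold restrict chainFn
  rw [h0]
  classical exact if_congr (key _) rfl rfl

include he in
lemma restrict_chainFn_true {j : ℕ} (hj : j < r) (K : Finset Bool) (k : Bool) :
    restrict (chainFn e j K) (e (.inr (.inr (⟨j, hj⟩, k)))) true =
      chainFn e j (K.erase k) := by
  funext x
  have hup : ∀ p, p ≠ .inr (.inr (⟨j, hj⟩, k)) →
      Function.update x (e (.inr (.inr (⟨j, hj⟩, k)))) true (e p) = x (e p) := fun p hp =>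
    Function.update_of_ne (fun h => hp (he h)) _ _
  have h0 : chosenChain e (Function.update x (e (.inr (.inr (⟨j, hj⟩, k)))) true) =
      chosenChain e x := by
    unfold chosenChain
    congr 1
    funext l
    exact hup _ (by simp)
  have key : ∀ a, ChainTrue e j K a (Function.update x (e (.inr (.inr (⟨j, hj⟩, k)))) true) ↔
      ChainTrue e j (K.erase k) a x := by
    intro a
    unfold ChainTrue
    refine exists_congr fun i => ?_
    have h1 : ∀ i' : Fin r, Function.update x (e (.inr (.inr (⟨j, hj⟩, k)))) true
      (e (.inr (.inl (a, i')))) = x (e (.inr (.inl (a, i')))) := fun i' => hup _ (by simp)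
    simp only [h1, mem_erase]
    refine and_congr_right fun _ => and_congr_right fun _ => and_congr_right fun _ =>
      forall_congr' fun k' => ?_
    by_cases hc : i = ⟨j, hj⟩ ∧ k' = k
    · obtain ⟨rfl, rfl⟩ := hc
      simp
    · rw [hup _ (by simpa using hc)]
      have : ((i : ℕ) = j → k' ≠ k ∧ k' ∈ K) ↔ ((i : ℕ) = j → k' ∈ K) := by
        refine imp_congr_right fun h => and_iff_right fun h' => hc ⟨Fin.ext h, h'⟩
      rw [this]
  unfold restrict chainFn
  rw [h0]
  classical exact if_congr (key _) rfl rfl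

-- The answer `0` rules out the index `j`; the answer `1` leaves one condition less there. An error
-- of 0 is inherited by both children, since it is their average.
include he in
lemma exists_children_of_eval_eq_chainFn {j : ℕ} (hj : j < r) {K : Finset Bool}
    (hK : K.Nonempty) {T : DecisionTree n} (hT : QueriesInfluential (chainFn e j K) T)
    (heval : T.eval = chainFn e j K) :
    ∃ k ∈ K, ∃ t₀ t₁ : DecisionTree n, T.size = t₀.size + t₁.size ∧
      (QueriesInfluential (chainFn e (j + 1) univ) t₀ ∧ t₀.eval = chainFn e (j + 1) univ) ∧
      (QueriesInfluential (chainFn e j (K.erase k)) t₁ ∧ t₁.eval = chainFn e j (K.erase k)) := by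
  cases T with
  | leaf a =>
    exfalso
    obtain ⟨k, hk⟩ := hK
    have h1 := le_influence_chainFn he hj hk
    rw [influence_const (a := a) (fun x => by rw [← heval]; rfl)] at h1
    exact absurd h1 (not_le.2 (by positivity))
  | node i t₀ t₁ =>
    obtain ⟨k, hk, rfl⟩ := exists_of_isMostInfluential_chainFn he hj hK hT.1.1
    obtain ⟨-, h₀, h₁⟩ := hT
    have herr := QueriesInfluential.error_node h₀ h₁
    rw [heval, error_self] at herr
    have n0 := error_nonneg t₀.eval (restrict (chainFn e j K) (e (.inr (.inr (⟨j, hj⟩, k)))) false)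
    have n1 := error_nonneg t₁.eval (restrict (chainFn e j K) (e (.inr (.inr (⟨j, hj⟩, k)))) true)
    have e0 := eq_of_error_nonpos (show error t₀.eval _ ≤ 0 by linarith)
    have e1 := eq_of_error_nonpos (show error t₁.eval _ ≤ 0 by linarith)
    rw [restrict_chainFn_false he hj hk] at h₀ e0
    rw [restrict_chainFn_true he hj] at h₁ e1
    exact ⟨k, hk, t₀, t₁, rfl, ⟨h₀, e0⟩, ⟨h₁, e1⟩⟩

-- The answer `0` to one bit of the pair, and the answers `1`, `0` to its two bits, both lead to the
-- next index. A pair instead of a single bit is what makes the size double.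
include he in
lemma two_pow_le_size_of_eval_eq_chainFn {d j : ℕ} (hd : j + d = r) {T : DecisionTree n}
    (hT : QueriesInfluential (chainFn e j univ) T) (heval : T.eval = chainFn e j univ) :
    2 ^ d ≤ T.size := by
  induction d generalizing j T with
  | zero => exact T.size_pos
  | succ d ih =>
    have hj : j < r := by omega
    obtain ⟨k, -, t₀, t₁, hs, ⟨hq, hev⟩, hq₁, hev₁⟩ :=
      exists_children_of_eval_eq_chainFn he hj univ_nonempty hT heval
    obtain ⟨k', -, s₀, s₁, hs', ⟨hq', hev'⟩, -⟩ :=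
      exists_children_of_eval_eq_chainFn he hj ⟨!k, by simp⟩ hq₁ hev₁
    have h1 := ih (by omega) hq hev
    have h2 := ih (by omega) hq' hev'
    rw [pow_succ]
    omega

/-! ### Decision tree size of the chain function -/

open Classical in
lemma dtSize_chain_le (e : ChainVar r → Fin n) (a : Bool) (d j : ℕ) (hd : j + d = r) :
    dtSize (fun x => if ∃ i : Fin r, j ≤ i ∧
      -- Unlike in `ChainTrue`, the chain bits before `j` are ignored: a tree that walks down the
      -- chain has already seen that they are 1.
      (∀ i' < i, j ≤ i' → x (e (.inr (.inl (a, i')))) = true) ∧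
      x (e (.inr (.inl (a, i)))) = false ∧ ∀ k, x (e (.inr (.inr (i, k)))) = true then 1 else -1)
      ≤ 4 * d + 1 := by
  induction d generalizing j with
  | zero =>
    refine (dtSize_const (a := -1) fun x => if_neg ?_).le
    rintro ⟨i, hi, -⟩
    omega
  | succ d ih =>
    have hj : j < r := by omega
    let p : BoolFn n := fun x => if ∀ k, x (e (.inr (.inr (⟨j, hj⟩, k)))) = true then 1 else -1
    have hp : dtSize p ≤ 2 ^ 2 := by
      refine (dtSize_le_two_pow (univ.image fun k => e (.inr (.inr (⟨j, hj⟩, k)))) p ?_).trans ?_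
      · intro x y h
        have : ∀ k, x (e (.inr (.inr (⟨j, hj⟩, k)))) = y (e (.inr (.inr (⟨j, hj⟩, k)))) :=
          fun k => h _ (by cases k <;> simp)
        simp only [p, this]
      · exact Nat.pow_le_pow_right (by norm_num) card_image_le
    have hih := ih (j + 1) (by omega)
    refine le_trans (le_of_eq ?_) ((dtSize_mux_le (e (.inr (.inl (a, ⟨j, hj⟩)))) _ p).trans
      ((Nat.add_le_add hih hp).trans (by omega)))
    congr 1
    funext x
    unfold mux
    by_cases hx : x (e (.inr (.inl (a, ⟨j, hj⟩)))) = true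
    · rw [if_pos hx]
      congr 1
      refine propext (exists_congr fun i => ⟨?_, ?_⟩)
      · rintro ⟨h1, h2, h3, h4⟩
        have hne : (i : ℕ) ≠ j := by
          rintro h
          rw [show i = ⟨j, hj⟩ from Fin.ext h, hx] at h3
          simp at h3
        exact ⟨by omega, fun i' hi' h => h2 i' hi' (by omega), h3, h4⟩
      · rintro ⟨h1, h2, h3, h4⟩
        refine ⟨by omega, fun i' hi' h => ?_, h3, h4⟩
        obtain h | h := h.lt_or_eq
        · exact h2 i' hi' h
        · rw [show i' = ⟨j, hj⟩ from Fin.ext h.symm, hx]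
    · rw [if_neg hx]
      congr 1
      refine propext ⟨?_, fun h => ⟨⟨j, hj⟩, le_rfl, fun i' hi' h => ?_, by simpa using hx, h⟩⟩
      · rintro ⟨i, h1, h2, h3, h4⟩
        have hi : i = ⟨j, hj⟩ := by
          refine le_antisymm ?_ h1
          by_contra! hlt
          exact hx (h2 _ hlt le_rfl)
        subst hi
        exact h4
      · exact absurd hi' (not_lt.2 h)

lemma dtSize_chainFn_le (e : ChainVar r → Fin n) (he : Function.Injective e) :
    dtSize (chainFn e 0 univ) ≤ 8 * (4 * r + 1) := by
  classical
  refine (dtSize_le_two_pow_mul (univ.image fun l => e (.inl l)) (4 * r + 1) _ fun v => ?_).trans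
    (Nat.mul_le_mul_right _ (Nat.pow_le_pow_right (by norm_num) (card_image_le (s := univ))))
  refine le_trans (le_of_eq ?_) (dtSize_chain_le e (chosenChain e v) r 0 (by simp))
  congr 1
  funext x
  have h1 : chosenChain e ((univ.image fun l => e (.inl l)).piecewise v x) = chosenChain e v :=
    dependsOn_chosenChain fun i hi => piecewise_eq_of_mem _ _ _ (by simpa using hi)
  have h2 : ∀ p, (univ.image fun l => e (.inl l)).piecewise v x (e (.inr p)) = x (e (.inr p)) :=
    fun p => piecewise_eq_of_notMem _ _ _ (by simp [he.eq_iff])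
  simp [chainFn, ChainTrue, h1, h2]

include he in
lemma lt_dtSize_chainFn : r < dtSize (chainFn e 0 univ) := by
  classical
  refine lt_of_le_of_lt ?_ (card_relevant_lt_dtSize _)
  refine (card_fin r).symm.trans_le ?_
  refine card_le_card_of_injOn (fun i => e (.inr (.inr (i, true)))) ?_ ?_
  · intro i _
    simp only [coe_filter, mem_univ, true_and, Set.mem_ofPred_eq]
    intro h0
    rw [influence_eq_zero_iff] at h0
    -- All bits are 1 except bit `i` of both chains, so the first 0 is at `i` whichever chain is
    -- chosen, and the `i`-th pair decides.
    let x : Fin n → Bool := fun v => decide (v ∉ Set.range fun a => e (.inr (.inl (a, i))))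
    have hx : ∀ p, x (e p) = decide (∀ a, p ≠ .inr (.inl (a, i))) := by
      intro p
      simp [x, he.eq_iff]
    have h1 : ChainTrue e 0 univ (chosenChain e x) x :=
      ⟨i, by simp, fun i' hi' => by simp [hx, hi'.ne], by simp [hx], fun k => by simp [hx]⟩
    have h2 := h0 x false
    rw [← not_not (a := _ = _)] at h2
    refine h2 (chainFn_ne_iff.2 ?_)
    rw [iff_true_right h1]
    rintro ⟨i', -, h3, h4, h5⟩
    rw [Function.update_of_ne (he.ne (by simp)), hx] at h4
    have hii : i' = i := by simpa using h4
    subst hii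
    simpa using h5 true
  · intro i _ i' _ h
    simpa [he.eq_iff] using h

end chain

theorem exists_exact {n : ℕ} (hn : 1 ≤ n) :
    ∃ f : BoolFn n, 1 / 16 * (n : ℝ) ≤ dtSize f ∧ (dtSize f : ℝ) ≤ 40 * n ∧
      (2 : ℝ) ^ (1 / 40 * (dtSize f : ℝ)) ≤ topDownDTSize f 0 := by
  -- A chain of length `r` needs `3 + 4 * r` variables, which leaves no room for `r = 1` here; a
  -- function of one variable satisfies the bounds.
  by_cases h7 : n < 7
  · let i : Fin n := ⟨0, hn⟩
    let f : BoolFn n := mux i (fun _ => 1) (fun _ => -1)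
    have h1 : dtSize f ≤ 2 := by
      refine (dtSize_mux_le _ _ _).trans ?_
      rw [dtSize_const (a := 1) fun _ => rfl, dtSize_const (a := -1) fun _ => rfl]
    have h0 := dtSize_pos f
    obtain ⟨T, -, hT, hs⟩ := exists_size_eq_topDownDTSize f le_rfl
    have h2 : 2 ≤ topDownDTSize f 0 := by
      rw [← hs]
      have hT' := eq_of_error_nonpos hT
      cases T with
      | leaf a =>
        exfalso
        have ht := congrFun hT' fun _ => true
        have hf := congrFun hT' fun _ => false
        simp only [DTree.eval, f, mux, if_true, Bool.false_eq_true, if_false] at ht hf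
        rw [ht] at hf
        exact absurd hf (by decide)
      | node i t₀ t₁ =>
        have := t₀.size_pos
        have := t₁.size_pos
        simp only [DTree.size]
        omega
    have hn' : (n : ℝ) ≤ 6 := by exact_mod_cast Nat.lt_succ_iff.1 h7
    have hn1 : (1 : ℝ) ≤ n := by exact_mod_cast hn
    have h1' : (dtSize f : ℝ) ≤ 2 := by exact_mod_cast h1
    have h0' : (1 : ℝ) ≤ dtSize f := by exact_mod_cast h0
    have h2' : (2 : ℝ) ≤ topDownDTSize f 0 := by exact_mod_cast h2
    refine ⟨f, by linarith, by linarith, le_trans ?_ h2'⟩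
    calc (2 : ℝ) ^ (1 / 40 * (dtSize f : ℝ)) ≤ 2 ^ (1 : ℝ) :=
          Real.rpow_le_rpow_of_exponent_le (by norm_num) (by linarith)
      _ = 2 := Real.rpow_one 2
  · let r := (n - 3) / 4
    have hcard : Fintype.card (ChainVar r) ≤ Fintype.card (Fin n) := by
      simp only [Fintype.card_sum, Fintype.card_prod, Fintype.card_fin, Fintype.card_bool]
      omega
    obtain ⟨e⟩ := Function.Embedding.nonempty_of_card_le hcard
    have he := e.injective
    have h1 := dtSize_chainFn_le e he
    have h2 := lt_dtSize_chainFn he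
    obtain ⟨T, hq, hT, hs⟩ := exists_size_eq_topDownDTSize (chainFn e 0 univ) le_rfl
    have h3 := two_pow_le_size_of_eval_eq_chainFn he (zero_add r) hq (eq_of_error_nonpos hT)
    rw [hs] at h3
    have hr1 : 1 ≤ r := by omega
    have hrn : 4 * r ≤ n := by omega
    have hnr : n ≤ 16 * r := by omega
    have h1' : (dtSize (chainFn e 0 univ) : ℝ) ≤ 40 * r := by
      exact_mod_cast h1.trans (by omega)
    have h2' : (r : ℝ) ≤ dtSize (chainFn e 0 univ) := by exact_mod_cast h2.le
    have hrn' : (4 * r : ℝ) ≤ n := by exact_mod_cast hrn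
    have hnr' : (n : ℝ) ≤ 16 * r := by exact_mod_cast hnr
    have h3' : (2 : ℝ) ^ r ≤ topDownDTSize (chainFn e 0 univ) 0 := by exact_mod_cast h3
    refine ⟨chainFn e 0 univ, by linarith, by linarith, le_trans ?_ h3'⟩
    rw [← Real.rpow_natCast]
    exact Real.rpow_le_rpow_of_exponent_le (by norm_num) (by linarith)

/-! ### A selector of low sensitivity -/

/-- The group `k` is active: all bits of its header are `1`. -/
def HeaderActive {N w p : ℕ} (v : Fin N × (Fin w ⊕ Fin p) → Bool) (k : Fin N) : Prop :=
  ∀ h, v (k, .inl h) = true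

instance {N w p : ℕ} (v : Fin N × (Fin w ⊕ Fin p) → Bool) : DecidablePred (HeaderActive v) :=
  fun k => inferInstanceAs (Decidable (∀ h, v (k, .inl h) = true))

/-- The payload of the first active group. -/
def firstPayload {N w p : ℕ} (v : Fin N × (Fin w ⊕ Fin p) → Bool) : Option (Fin p → Bool) :=
  ((List.finRange N).find? fun k => HeaderActive v k).map fun k q => v (k, .inr q)

lemma firstPayload_eq_none {N w p : ℕ} {v : Fin N × (Fin w ⊕ Fin p) → Bool} :
    firstPayload v = none ↔ ∀ k, ¬ HeaderActive v k := by
  simp [firstPayload]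

lemma firstPayload_eq_map {N w p : ℕ} {v v' : Fin N × (Fin w ⊕ Fin p) → Bool}
    (φ : (Fin p → Bool) → (Fin p → Bool)) (h : ∀ k, HeaderActive v' k ↔ HeaderActive v k)
    (h' : ∀ k, HeaderActive v k → (fun q => v' (k, .inr q)) = φ fun q => v (k, .inr q)) :
    firstPayload v' = (firstPayload v).map φ := by
  unfold firstPayload
  simp only [h, Option.map_map]
  refine Option.map_congr fun k hk => ?_
  exact h' k (by simpa using List.find?_some hk)

lemma firstPayload_congr {N w p : ℕ} {v v' : Fin N × (Fin w ⊕ Fin p) → Bool}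
    (h : ∀ k, HeaderActive v' k ↔ HeaderActive v k)
    (h' : ∀ k, HeaderActive v k → ∀ q, v' (k, .inr q) = v (k, .inr q)) :
    firstPayload v' = firstPayload v := by
  rw [firstPayload_eq_map id h fun k hk => funext (h' k hk), Option.map_id, id]

section selector

variable {n N w p : ℕ} {X : Fin N × (Fin w ⊕ Fin p) → Fin n} (hX : Function.Injective X)

include hX in
lemma pr_headerActive (k : Fin N) :
    pr (fun x : Fin n → Bool => HeaderActive (fun i => x (X i)) k) = (1 / 2) ^ w := by
  have h := pr_subcube_comp hX (univ.image fun h => (k, .inl h)) fun _ => true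
  rw [card_image_of_injective _ (fun a b hab => by simpa using hab), card_univ, Fintype.card_fin] at h
  rw [← h]
  exact pr_congr fun x => by simp [HeaderActive]

include hX in
lemma pr_firstPayload_eq_none :
    pr (fun x : Fin n → Bool => firstPayload (fun i => x (X i)) = none) =
      (1 - (1 / 2) ^ w) ^ N := by
  simp_rw [firstPayload_eq_none]
  have key : ∀ s : Finset (Fin N), pr (fun x : Fin n → Bool =>
      ∀ k ∈ s, ¬ HeaderActive (fun i => x (X i)) k) = (1 - (1 / 2) ^ w) ^ s.card := by
    intro s
    induction s using Finset.induction_on with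
    | empty => rw [pr_of_forall (by simp)]; simp
    | insert a s ha ih =>
      have hneg : pr (fun x : Fin n → Bool => ¬ HeaderActive (fun i => x (X i)) a) =
          1 - (1 / 2) ^ w := by
        have := pr_and_add_pr_and_not (fun _ : Fin n → Bool => True)
          (fun x => HeaderActive (fun i => x (X i)) a)
        rw [pr_of_forall (P := fun _ => True) fun _ => trivial] at this
        simp only [true_and] at this
        rw [pr_headerActive hX] at this
        linarith
      rw [card_insert_of_notMem ha, pow_succ', ← ih, ← hneg,
        ← pr_and_of_dependsOn (A := Set.range fun h => X (a, .inl h))]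
      · exact pr_congr fun x => by simp
      · intro x y h
        simp only [HeaderActive]
        simp only [h _ ⟨_, rfl⟩]
      · intro x y h
        simp only [eq_iff_iff]
        refine forall₂_congr fun k hk => ?_
        have : ∀ h', x (X (k, .inl h')) = y (X (k, .inl h')) := fun h' => h _ (by
          rintro ⟨h'', heq⟩
          have := hX heq
          simp only [Prod.mk.injEq] at this
          exact ha (this.1 ▸ hk))
        simp only [HeaderActive, this]
  have h := key univ
  rw [card_univ, Fintype.card_fin] at h
  rw [← h]
  exact pr_congr fun x => by simp

-- Adding a fixed string to all payloads preserves the measure and the headers, so all payloads are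
-- equally likely and share the mass left by `none`.
include hX in
lemma pr_firstPayload_eq_some (b : Fin p → Bool) :
    pr (fun x : Fin n → Bool => firstPayload (fun i => x (X i)) = some b) =
      (1 - (1 - (1 / 2) ^ w) ^ N) / 2 ^ p := by
  have hshift : ∀ b', pr (fun x : Fin n → Bool => firstPayload (fun i => x (X i)) = some b') =
      pr (fun x : Fin n → Bool => firstPayload (fun i => x (X i)) = some b) := by
    intro b'
    let c : Fin n → Bool := Function.extend X
      (fun i => Sum.elim (fun _ => false) (fun q => xor (b' q) (b q)) i.2) fun _ => false
    have hc : ∀ i, c (X i) = Sum.elim (fun _ => false) (fun q => xor (b' q) (b q)) i.2 :=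
      fun i => hX.extend_apply _ _ _
    let σ : (Fin n → Bool) → (Fin n → Bool) := fun x i => xor (x i) (c i)
    have hσ : Function.Involutive σ := fun x => funext fun i => by simp [σ]
    rw [← pr_comp_equiv hσ.toPerm]
    refine pr_congr fun x => ?_
    have hmap : firstPayload (fun i => σ x (X i)) =
        (firstPayload fun i => x (X i)).map fun v q => xor (v q) (xor (b' q) (b q)) :=
      firstPayload_eq_map _ (fun k => by simp [HeaderActive, σ, hc])
        fun k _ => by funext q; simp [σ, hc]
    simp only [Function.Involutive.coe_toPerm, hmap, Option.map_eq_some_iff]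
    constructor
    · rintro ⟨v, hv, hvb⟩
      rw [hv]
      congr 1
      funext q
      have := congrFun hvb q
      cases hvq : v q <;> cases hbq : b q <;> cases hbq' : b' q <;> simp_all
    · intro h
      refine ⟨b, h, ?_⟩
      funext q
      cases b q <;> simp
  have hsum := sum_pr_and_eq (fun _ : Fin n → Bool => True)
    (fun x => firstPayload (fun i => x (X i)))
  rw [pr_of_forall (P := fun _ => True) fun _ => trivial, Fintype.sum_option] at hsum
  simp only [true_and] at hsum
  simp_rw [hshift] at hsum
  rw [pr_firstPayload_eq_none hX, sum_const, card_univ, nsmul_eq_mul, Fintype.card_fun,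
    Fintype.card_fin, Fintype.card_bool] at hsum
  push_cast at hsum
  rw [eq_div_iff (by positivity)]
  linarith

-- A header bit matters only if the other `w - 1` bits of its header are 1, a payload bit only if
-- its group is active.
include hX in
lemma pr_firstPayload_flipAt_le (i : Fin N × (Fin w ⊕ Fin p)) :
    pr (fun x : Fin n → Bool => firstPayload (fun i' => flipAt x (X i) (X i')) ≠
      firstPayload (fun i' => x (X i'))) ≤ (1 / 2) ^ (w - 1) := by
  have hfl : ∀ (x : Fin n → Bool) i', i' ≠ i → flipAt x (X i) (X i') = x (X i') :=
    fun x i' h => flipAt_of_ne x fun h' => h (hX h')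
  obtain ⟨k, h | q⟩ := i
  · have hcube := pr_subcube_comp hX ((univ.erase h).image
      fun h => (k, .inl h)) fun _ => true
    rw [card_image_of_injective _ (fun a b hab => by simpa using hab), card_erase_of_mem (mem_univ h), card_univ, Fintype.card_fin] at hcube
    rw [← hcube]
    refine pr_mono fun x hx => ?_
    by_contra hc
    simp only [mem_image, mem_erase, mem_univ, and_true, forall_exists_index, and_imp, forall_apply_eq_imp_iff₂, not_forall] at hc
    obtain ⟨h', hne, hh'⟩ := hc
    refine hx (firstPayload_congr (fun k' => ?_) fun k' _ q => hfl _ _ (by simp))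
    by_cases hk : k' = k
    · subst hk
      refine iff_of_false (fun hact => hh' ?_) fun hact => hh' (hact h')
      exact (hfl x (k', .inl h') (by simpa using hne)).symm.trans (hact h')
    · have : ∀ h'', flipAt x (X (k, .inl h)) (X (k', .inl h'')) = x (X (k', .inl h'')) :=
        fun h'' => hfl _ _ (by simp [hk])
      simp only [HeaderActive, this]
  · refine le_trans (pr_mono (Q := fun x => HeaderActive (fun i => x (X i)) k) fun x hx => ?_)
      ((pr_headerActive hX k).le.trans
        (pow_le_pow_of_le_one (by norm_num) (by norm_num) (by omega)))
    by_contra hc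
    refine hx (firstPayload_congr (fun k' => ?_) fun k' hk' q' => hfl _ _ ?_)
    · have : ∀ h'', flipAt x (X (k, .inr q)) (X (k', .inl h'')) = x (X (k', .inl h'')) :=
        fun h'' => hfl _ _ (by simp)
      simp only [HeaderActive, this]
    · simp only [ne_eq, Prod.mk.injEq, not_and]
      rintro rfl
      exact absurd hk' hc

end selector

/-! ### Restrictions by paths -/

/-- The point that agrees with the answers along the path `π`, and with `x` elsewhere. -/
def follow {n : ℕ} : Path n → (Fin n → Bool) → (Fin n → Bool)
  | [], x => x
  | (i, b) :: π, x => Function.update (follow π x) i b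

/-- The variables that a path queries. -/
def queried {n : ℕ} (π : Path n) : Finset (Fin n) := (π.map Prod.fst).toFinset

lemma restrictPath_apply {n : ℕ} (f : BoolFn n) (π : Path n) (x : Fin n → Bool) :
    restrictPath f π x = f (follow π x) := by
  induction π generalizing f with
  | nil => rfl
  | cons q π ih => exact ih _

lemma restrictPath_concat {n : ℕ} (f : BoolFn n) (π : Path n) (i : Fin n) (b : Bool) :
    restrictPath f (π ++ [(i, b)]) = restrict (restrictPath f π) i b := by
  induction π generalizing f with
  | nil => rfl
  | cons q π ih => exact ih _

lemma follow_concat {n : ℕ} (π : Path n) (i : Fin n) (b : Bool) (x : Fin n → Bool) :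
    follow (π ++ [(i, b)]) x = follow π (Function.update x i b) := by
  induction π with
  | nil => rfl
  | cons q π ih => simp only [List.cons_append, follow, ih]

lemma mem_queried_cons {n : ℕ} {q : Fin n × Bool} {π : Path n} {i : Fin n} :
    i ∈ queried (q :: π) ↔ i = q.1 ∨ i ∈ queried π := by
  simp [queried]

lemma mem_queried_concat {n : ℕ} {π : Path n} {i j : Fin n} {b : Bool} :
    j ∈ queried (π ++ [(i, b)]) ↔ j ∈ queried π ∨ j = i := by
  simp [queried, or_comm]

lemma card_queried_le {n : ℕ} (π : Path n) : (queried π).card ≤ π.length :=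
  (List.toFinset_card_le _).trans_eq (List.length_map _)

lemma follow_of_notMem {n : ℕ} {π : Path n} {i : Fin n} (hi : i ∉ queried π) (x : Fin n → Bool) :
    follow π x i = x i := by
  induction π with
  | nil => rfl
  | cons q π ih =>
    rw [mem_queried_cons, not_or] at hi
    simp only [follow]
    rw [Function.update_of_ne hi.1, ih hi.2]

lemma follow_of_mem {n : ℕ} {π : Path n} {i : Fin n} (hi : i ∈ queried π) (x y : Fin n → Bool) :
    follow π x i = follow π y i := by
  induction π with
  | nil => simp [queried] at hi
  | cons q π ih =>
    simp only [follow]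
    by_cases hq : i = q.1
    · subst hq
      simp
    · rw [Function.update_of_ne hq, Function.update_of_ne hq]
      exact ih ((mem_queried_cons.1 hi).resolve_left hq)

lemma follow_congr {n : ℕ} {π : Path n} {i : Fin n} {x y : Fin n → Bool} (h : x i = y i) :
    follow π x i = follow π y i := by
  by_cases hi : i ∈ queried π
  · exact follow_of_mem hi x y
  · rw [follow_of_notMem hi, follow_of_notMem hi, h]

lemma follow_flipAt_of_notMem {n : ℕ} {π : Path n} {i : Fin n} (hi : i ∉ queried π)
    (x : Fin n → Bool) : follow π (flipAt x i) = flipAt (follow π x) i := by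
  funext j
  by_cases hj : j = i
  · subst hj
    rw [follow_of_notMem hi, flipAt_same, flipAt_same, follow_of_notMem hi]
  · rw [flipAt_of_ne _ hj, follow_congr (flipAt_of_ne x hj)]

/-! ### Parities of selected blocks -/

/-- The parity of the variables `y j`. -/
def parityOn {n m : ℕ} (y : Fin m → Fin n) : BoolFn n := fun x => ∏ j, if x (y j) then -1 else 1

lemma parityOn_flipAt {n m : ℕ} {y : Fin m → Fin n} (hy : Function.Injective y) (j : Fin m)
    (x : Fin n → Bool) : parityOn y (flipAt x (y j)) = -parityOn y x := by
  unfold parityOn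
  rw [← mul_prod_erase univ _ (mem_univ j), ← mul_prod_erase univ _ (mem_univ j), flipAt_same,
    ← neg_mul]
  congr 1
  · cases x (y j) <;> simp
  · refine prod_congr rfl fun j' hj' => ?_
    rw [flipAt_of_ne _ (hy.ne (ne_of_mem_erase hj'))]

/-- The parity of the block of variables that `sel` selects. -/
def selectedParity {n m : ℕ} {κ β : Type} (sel : (κ → Bool) → Option β) (X : κ → Fin n)
    (Y : β → Fin m → Fin n) : BoolFn n :=
  fun x => (sel fun k => x (X k)).elim 1 fun b => parityOn (Y b) x

/-- The function among the `F c` that `gate` chooses, or else `g`. -/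
def gated {n : ℕ} {τ : Type} (gate : (Fin n → Bool) → Option τ) (F : τ → BoolFn n)
    (g : BoolFn n) : BoolFn n :=
  fun x => (gate x).elim (g x) fun c => F c x

/-- The flip of `i` preserves `E` and exchanges agreement and disagreement with `a`. -/
lemma pr_and_ne_eq_half {n : ℕ} {f : BoolFn n} {E : (Fin n → Bool) → Prop} {i : Fin n}
    (hE : ∀ x, E (flipAt x i) ↔ E x) (hf : ∀ x, E x → f (flipAt x i) = -f x) (a : ℤˣ) :
    pr (fun x => E x ∧ a ≠ f x) = pr E / 2 := by
  have h1 := pr_and_add_pr_and_not E (fun x => a ≠ f x)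
  have h2 : pr (fun x => E x ∧ ¬ a ≠ f x) = pr (fun x => E x ∧ a ≠ f x) := by
    rw [← pr_flipAt i]
    refine pr_congr fun x => ?_
    rw [hE]
    refine and_congr_right fun hx => ?_
    rw [hf x hx]
    obtain rfl | rfl := Int.units_eq_one_or a <;> obtain h | h := Int.units_eq_one_or (f x) <;>
      rw [h] <;> decide
  linarith

section gated

variable {n m : ℕ} {τ κ β : Type} {gate : (Fin n → Bool) → Option τ} {g : BoolFn n}
  {sel : (κ → Bool) → Option β} {X : τ → κ → Fin n} {Y : τ → β → Fin m → Fin n}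
  {Z : Set (Fin n)} {ρ : ℝ}

/-- The hypotheses on the parts of a gated family of selected parities: they use disjoint sets of
variables, the selected block is uniformly distributed, and the selector is not sensitive. -/
structure IsHardFamily (gate : (Fin n → Bool) → Option τ) (g : BoolFn n)
    (sel : (κ → Bool) → Option β) (X : τ → κ → Fin n) (Y : τ → β → Fin m → Fin n)
    (Z : Set (Fin n)) (ρ : ℝ) : Prop where
  dependsOn_gate : DependsOn gate Z
  X_notMem : ∀ c k, X c k ∉ Z
  Y_notMem : ∀ c b j, Y c b j ∉ Z
  Y_injective : Function.Injective fun q : τ × β × Fin m => Y q.1 q.2.1 q.2.2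
  X_ne_Y : ∀ c k c' b j, X c k ≠ Y c' b j
  X_injective : Function.Injective fun q : τ × κ => X q.1 q.2
  influence_g : ∀ c k, influence g (X c k) = 0
  pr_sel : ∀ c b, pr (fun x => sel (fun k => x (X c k)) = some b) = ρ
  pr_sel_flipAt : ∀ c k, pr (fun x => sel (fun k' => flipAt x (X c k) (X c k')) ≠
    sel fun k' => x (X c k')) < ρ

/-- No variable of a selector is queried before all variables of its blocks. -/
def BlocksFirst (X : τ → κ → Fin n) (Y : τ → β → Fin m → Fin n) (π : Path n) : Prop :=
  ∀ c k, X c k ∈ queried π → ∀ b j, Y c b j ∈ queried π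

namespace IsHardFamily

variable (H : IsHardFamily gate g sel X Y Z ρ)

include H in
lemma gate_follow_flipAt (π : Path n) {i : Fin n} (hi : i ∉ Z) (x : Fin n → Bool) :
    gate (follow π (flipAt x i)) = gate (follow π x) :=
  H.dependsOn_gate fun _ hj => follow_congr (flipAt_of_ne x fun h => hi (h ▸ hj))

include H in
lemma pr_gate_and (π : Path n) (c : τ) {Q : (Fin n → Bool) → Prop}
    (hQ : DependsOn Q (Set.range (X c))) :
    pr (fun x => gate (follow π x) = some c ∧ Q x) =
      pr (fun x => gate (follow π x) = some c) * pr Q := by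
  refine pr_and_of_dependsOn (A := Z) ?_ (hQ.mono ?_)
  · intro x y h
    have := H.dependsOn_gate (x := follow π x) (y := follow π y) fun i hi => follow_congr (h i hi)
    simp only [this]
  · rintro _ ⟨k, rfl⟩
    exact H.X_notMem c k

-- The flip matters only if the gate chooses `c` and the output of the selector changes. These
-- events are independent, and the path does not bias the selector as long as it has queried none of
-- its variables.
include H in
lemma influence_X_le (π : Path n) (c : τ) (k : κ) (hX : ∀ k, X c k ∉ queried π) :
    influence (restrictPath (gated gate (fun c => selectedParity sel (X c) (Y c)) g) π) (X c k) ≤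
      pr (fun x => gate (follow π x) = some c) * pr (fun x =>
        sel (fun k' => flipAt x (X c k) (X c k')) ≠ sel fun k' => x (X c k')) := by
  rw [← H.pr_gate_and π c, influence_eq]
  · refine pr_mono fun x hx => ?_
    simp only [restrictPath_apply, gated, H.gate_follow_flipAt π (H.X_notMem c k)] at hx
    rw [follow_flipAt_of_notMem (hX k)] at hx
    cases hg : gate (follow π x) with
    | none =>
      rw [hg] at hx
      simp only [Option.elim_none] at hx
      exact absurd (influence_eq_zero_iff.1 (H.influence_g c k) _ _).symm hx
    | some c' =>
      rw [hg] at hx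
      simp only [Option.elim_some, selectedParity] at hx
      have hY : ∀ b, parityOn (Y c' b) (flipAt (follow π x) (X c k)) =
          parityOn (Y c' b) (follow π x) := by
        intro b
        unfold parityOn
        refine prod_congr rfl fun j _ => ?_
        rw [flipAt_of_ne _ (H.X_ne_Y c k c' b j).symm]
      simp only [hY] at hx
      by_cases hc : c' = c
      · subst hc
        refine ⟨rfl, fun h => hx ?_⟩
        have h1 : (fun k' => flipAt (follow π x) (X c' k) (X c' k')) =
            fun k' => flipAt x (X c' k) (X c' k') := funext fun k' => by
          rw [← follow_flipAt_of_notMem (hX k), follow_of_notMem (hX k')]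
        have h2 : (fun k' => follow π x (X c' k')) = fun k' => x (X c' k') :=
          funext fun k' => follow_of_notMem (hX k') x
        rw [h1, h2, h]
      · refine absurd ?_ hx
        have h1 : (fun k' => flipAt (follow π x) (X c k) (X c' k')) =
            fun k' => follow π x (X c' k') := funext fun k' => flipAt_of_ne _ fun h => hc
          (congrArg Prod.fst (H.X_injective (a₁ := (c', k')) (a₂ := (c, k)) h))
        rw [h1]
  · intro x y h
    have h1 : ∀ k', x (X c k') = y (X c k') := fun k' => h _ ⟨k', rfl⟩
    have h2 : ∀ k', flipAt x (X c k) (X c k') = flipAt y (X c k) (X c k') := by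
      intro k'
      by_cases hk : X c k' = X c k
      · rw [hk, flipAt_same, flipAt_same, h1]
      · rw [flipAt_of_ne _ hk, flipAt_of_ne _ hk, h1]
    simp only [h1, h2]

include H in
lemma selectedParity_flipAt {π : Path n} {c : τ} {b : β} {j : Fin m}
    (hX : ∀ k, X c k ∉ queried π) (hY : Y c b j ∉ queried π) {x : Fin n → Bool}
    (hgate : gate (follow π x) = some c) (hsel : sel (fun k => x (X c k)) = some b) :
    restrictPath (gated gate (fun c => selectedParity sel (X c) (Y c)) g) π (flipAt x (Y c b j)) =
      -restrictPath (gated gate (fun c => selectedParity sel (X c) (Y c)) g) π x := by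
  have h1 : (fun k' => follow π x (X c k')) = fun k' => x (X c k') :=
    funext fun k' => follow_of_notMem (hX k') x
  have h2 : (fun k' => flipAt (follow π x) (Y c b j) (X c k')) = fun k' => x (X c k') :=
    funext fun k' => by rw [flipAt_of_ne _ (H.X_ne_Y c k' c b j), follow_of_notMem (hX k') x]
  rw [restrictPath_apply, restrictPath_apply, gated, gated,
    H.gate_follow_flipAt π (H.Y_notMem c b j), hgate, follow_flipAt_of_notMem hY]
  simp only [Option.elim_some, selectedParity, h1, h2, hsel]
  refine parityOn_flipAt (fun _ _ h => ?_) j _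
  simpa using H.Y_injective (a₁ := (c, b, _)) (a₂ := (c, b, _)) h

include H in
lemma pr_gate_and_sel (π : Path n) (c : τ) (b : β) :
    pr (fun x => gate (follow π x) = some c ∧ sel (fun k => x (X c k)) = some b) =
      pr (fun x => gate (follow π x) = some c) * ρ := by
  rw [H.pr_gate_and π c, H.pr_sel]
  intro x y h
  have h1 : ∀ k', x (X c k') = y (X c k') := fun k' => h _ ⟨k', rfl⟩
  simp only [h1]

-- Once `c` and `b` are chosen, the value is a parity that contains the variable, so every flip
-- counts.
include H in
lemma le_influence_Y (π : Path n) (c : τ) (b : β) (j : Fin m) (hX : ∀ k, X c k ∉ queried π)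
    (hY : Y c b j ∉ queried π) :
    pr (fun x => gate (follow π x) = some c) * ρ ≤
      influence (restrictPath (gated gate (fun c => selectedParity sel (X c) (Y c)) g) π)
        (Y c b j) := by
  rw [← H.pr_gate_and_sel π c b, influence_eq]
  refine pr_mono fun x hx => ?_
  rw [H.selectedParity_flipAt hX hY hx.1 hx.2]
  obtain h | h := Int.units_eq_one_or
    (restrictPath (gated gate (fun c => selectedParity sel (X c) (Y c)) g) π x) <;>
    rw [h] <;> decide

-- The heart of (b): by `pr_sel_flipAt`, a variable of an untouched selector has less influence than
-- any unqueried variable of its blocks, so it cannot be the next query.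
include H in
lemma blocksFirst_concat {π : Path n} (hπ : BlocksFirst X Y π) {i : Fin n}
    (hi : IsMostInfluential
      (restrictPath (gated gate (fun c => selectedParity sel (X c) (Y c)) g) π) i)
    (hpos : 0 < influence
      (restrictPath (gated gate (fun c => selectedParity sel (X c) (Y c)) g) π) i) (b : Bool) :
    BlocksFirst X Y (π ++ [(i, b)]) := by
  intro c k hk b' j
  rw [mem_queried_concat] at hk ⊢
  by_cases hX : ∃ k', X c k' ∈ queried π
  · obtain ⟨k', hk'⟩ := hX
    exact Or.inl (hπ c k' hk' b' j)
  · push Not at hX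
    obtain hk | rfl := hk
    · exact absurd hk (hX k)
    · left
      by_contra hY
      have h1 := H.influence_X_le π c k hX
      have h2 := H.le_influence_Y π c b' j hX hY
      have h3 := hi (Y c b' j)
      have h4 := H.pr_sel_flipAt c k
      have h5 := pr_nonneg fun x => gate (follow π x) = some c
      -- If the path rules out `c`, then `X c k` has influence 0 and is not queried at all.
      obtain h6 | h6 := h5.eq_or_lt
      · rw [← h6, zero_mul] at h1
        linarith
      · have := mul_lt_mul_of_pos_left h4 h6
        linarith

include H in
lemma X_notMem_queried [Fintype β] {π : Path n} (hπ : BlocksFirst X Y π)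
    (hlen : π.length < m * Fintype.card β) (c : τ) (k : κ) : X c k ∉ queried π := by
  intro hk
  have h1 : (univ : Finset (β × Fin m)).card ≤ (queried π).card := by
    refine card_le_card_of_injOn (fun q => Y c q.1 q.2) (fun q _ => hπ c k hk _ _) ?_
    intro q _ q' _ h
    have := H.Y_injective (a₁ := (c, q)) (a₂ := (c, q')) h
    simpa using this
  rw [card_univ, Fintype.card_prod, Fintype.card_fin] at h1
  have := card_queried_le π
  rw [mul_comm] at hlen
  omega

-- A block with an unqueried variable has an unbiased parity, so any label errs on half of its
-- weight. For each `c`, at most `π.length / m` blocks can be queried completely.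
include H in
lemma le_error_leaf [Fintype τ] [Fintype β] {π : Path n} (hm : 0 < m)
    (hX : ∀ c k, X c k ∉ queried π) (a : ℤˣ) (hρ : 0 ≤ ρ) :
    1 / 2 * (ρ * (Fintype.card β - π.length / m)) *
        (1 - pr fun x => gate (follow π x) = none) ≤
      pr (fun x => a ≠
        restrictPath (gated gate (fun c => selectedParity sel (X c) (Y c)) g) π x) := by
  classical
  set f := restrictPath (gated gate (fun c => selectedParity sel (X c) (Y c)) g) π with hf
  have hgate : ∀ c : τ, 1 / 2 * (ρ * (Fintype.card β - π.length / m)) *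
      pr (fun x => gate (follow π x) = some c) ≤
        pr (fun x => a ≠ f x ∧ gate (follow π x) = some c) := by
    intro c
    have hblock : ∀ b ∈ univ.filter (fun b => ∃ j, Y c b j ∉ queried π),
        pr (fun x => gate (follow π x) = some c) * ρ / 2 ≤
          pr (fun x => (a ≠ f x ∧ gate (follow π x) = some c) ∧
            sel (fun k => x (X c k)) = some b) := by
      intro b hb
      simp only [mem_filter, mem_univ, true_and] at hb
      obtain ⟨j, hj⟩ := hb
      rw [← H.pr_gate_and_sel π c b, ← pr_and_ne_eq_half (f := f) (i := Y c b j) ?_ ?_ a]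
      · exact pr_mono fun x hx => ⟨⟨hx.2, hx.1.1⟩, hx.1.2⟩
      · intro x
        rw [H.gate_follow_flipAt π (H.Y_notMem c b j)]
        have : ∀ k, flipAt x (Y c b j) (X c k) = x (X c k) :=
          fun k => flipAt_of_ne _ (H.X_ne_Y c k c b j)
        simp only [this]
      · rintro x ⟨h1, h2⟩
        exact H.selectedParity_flipAt (hX c) hj h1 h2
    have hfin : ((univ.filter fun b => ¬ ∃ j, Y c b j ∉ queried π) ×ˢ
        (univ : Finset (Fin m))).card ≤ (queried π).card := by
      refine card_le_card_of_injOn (fun q => Y c q.1 q.2) ?_ ?_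
      · intro q hq
        simp only [coe_product, Set.mem_prod, mem_coe, mem_filter, mem_univ, true_and,
          not_exists, not_not] at hq
        exact hq.1 q.2
      · intro q _ q' _ h
        have := H.Y_injective (a₁ := (c, q)) (a₂ := (c, q')) h
        simpa using this
    rw [card_product, card_univ, Fintype.card_fin] at hfin
    have hcard := card_filter_add_card_filter_not (s := (univ : Finset β))
      (fun b => ∃ j, Y c b j ∉ queried π)
    rw [card_univ] at hcard
    have hlen := hfin.trans (card_queried_le π)
    have hm' : (0 : ℝ) < m := by exact_mod_cast hm
    have hfin' : ((univ.filter fun b => ¬ ∃ j, Y c b j ∉ queried π).card : ℝ) ≤ π.length / m := by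
      rw [le_div_iff₀ hm']
      exact_mod_cast hlen
    have hcard' : (Fintype.card β : ℝ) - π.length / m ≤
        (univ.filter fun b => ∃ j, Y c b j ∉ queried π).card := by
      rw [← hcard]
      push_cast
      linarith
    have hG := pr_nonneg fun x => gate (follow π x) = some c
    calc 1 / 2 * (ρ * (Fintype.card β - π.length / m)) * pr (fun x => gate (follow π x) = some c)
        = (Fintype.card β - π.length / m) *
          (pr (fun x => gate (follow π x) = some c) * ρ / 2) := by ring
      _ ≤ (univ.filter fun b => ∃ j, Y c b j ∉ queried π).card *
          (pr (fun x => gate (follow π x) = some c) * ρ / 2) := by gcongr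
      _ ≤ ∑ b ∈ univ.filter (fun b => ∃ j, Y c b j ∉ queried π),
          pr (fun x => (a ≠ f x ∧ gate (follow π x) = some c) ∧
            sel (fun k => x (X c k)) = some b) := by
        rw [← nsmul_eq_mul]
        exact card_nsmul_le_sum _ _ _ hblock
      _ ≤ ∑ b, pr (fun x => (a ≠ f x ∧ gate (follow π x) = some c) ∧
            sel (fun k => x (X c k)) = some b) :=
        sum_le_sum_of_subset_of_nonneg (filter_subset _ _) fun _ _ _ => pr_nonneg _
      _ ≤ pr (fun x => a ≠ f x ∧ gate (follow π x) = some c) := by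
        rw [← sum_pr_and_eq (fun x => a ≠ f x ∧ gate (follow π x) = some c)
          (fun x => sel fun k => x (X c k)), Fintype.sum_option]
        exact le_add_of_nonneg_left (pr_nonneg _)
  have htot := sum_pr_and_eq (fun _ : Fin n → Bool => True) (fun x => gate (follow π x))
  rw [pr_of_forall (P := fun _ => True) fun _ => trivial, Fintype.sum_option] at htot
  simp only [true_and] at htot
  rw [← eq_sub_iff_add_eq'.2 htot, mul_sum, ← sum_pr_and_eq (fun x => a ≠ f x)
    (fun x => gate (follow π x)), Fintype.sum_option]
  exact (sum_le_sum fun c _ => hgate c).trans (le_add_of_nonneg_left (pr_nonneg _))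

include H in
lemma rho_mul_card_le_one [Fintype β] (c : τ) : ρ * Fintype.card β ≤ 1 := by
  have h := sum_pr_and_eq (fun _ : Fin n → Bool => True) (fun x => sel fun k => x (X c k))
  rw [pr_of_forall (P := fun _ => True) fun _ => trivial, Fintype.sum_option] at h
  simp only [true_and, H.pr_sel, sum_const, card_univ, nsmul_eq_mul] at h
  have := pr_nonneg fun x : Fin n → Bool => sel (fun k => x (X c k)) = none
  linarith

-- Leaves above depth `d` satisfy `le_error_leaf`. A deeper leaf may be perfect, but its weight is
-- at most `(1/2) ^ d`, and the size term pays for it. Both sides are averages over the children, so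
-- the bound propagates to the root.
include H in
lemma le_error [Fintype τ] [Fintype β] [Nonempty τ] (hm : 0 < m) (hρ : 0 ≤ ρ) {d : ℕ}
    (hd : d ≤ m * Fintype.card β) (S : DecisionTree n) (π : Path n) (hπ : BlocksFirst X Y π)
    (hS : QueriesInfluential
      (restrictPath (gated gate (fun c => selectedParity sel (X c) (Y c)) g) π) S) :
    1 / 2 * (ρ * (Fintype.card β - d / m)) * (1 - pr fun x => gate (follow π x) = none) -
        1 / 2 * (S.size * 2 ^ π.length / 2 ^ d) ≤
      error S.eval (restrictPath (gated gate (fun c => selectedParity sel (X c) (Y c)) g) π) := by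
  induction S generalizing π with
  | leaf a =>
    have hG0 := pr_nonneg fun x : Fin n → Bool => gate (follow π x) = none
    have hG1 := pr_le_one fun x : Fin n → Bool => gate (follow π x) = none
    by_cases hlen : π.length < d
    · refine le_trans ?_ ((H.le_error_leaf hm (H.X_notMem_queried hπ (hlen.trans_le hd)) a hρ).trans
        (error_eq _ _).ge)
      have : (0 : ℝ) ≤ 1 / 2 * ((DTree.leaf a : DecisionTree n).size * 2 ^ π.length / 2 ^ d) := by
        positivity
      have hlen' : (π.length : ℝ) ≤ d := by exact_mod_cast hlen.le
      refine (sub_le_self _ this).trans ?_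
      refine mul_le_mul_of_nonneg_right ?_ (by linarith)
      gcongr
    -- Here the left side is not positive: its first term is at most 1/2 since `ρ * card β ≤ 1`, and
    -- the size term is at least 1/2.
    · refine le_trans ?_ (error_nonneg _ _)
      have h1 : (1 : ℝ) ≤ 2 ^ π.length / 2 ^ d := by
        rw [one_le_div (by positivity)]
        exact pow_le_pow_right₀ (by norm_num) (not_lt.1 hlen)
      have h2 := H.rho_mul_card_le_one (Classical.arbitrary τ)
      have h3 : 0 ≤ ρ * (d / m : ℝ) := by positivity
      have h4 : ρ * (Fintype.card β - d / m) * (1 - pr fun x => gate (follow π x) = none) ≤ 1 := by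
        refine (mul_le_mul_of_nonneg_right (?_ : _ ≤ (1 : ℝ)) (by linarith)).trans (by linarith)
        rw [mul_sub]
        linarith
      simp only [DTree.size, Nat.cast_one, one_mul]
      linarith
  | node i t₀ t₁ ih₀ ih₁ =>
    obtain ⟨⟨hi, hpos⟩, h₀, h₁⟩ := hS
    rw [QueriesInfluential.error_node h₀ h₁]
    rw [← restrictPath_concat] at h₀ h₁ ⊢
    rw [← restrictPath_concat]
    have e₀ := ih₀ _ (H.blocksFirst_concat hπ hi hpos false) h₀
    have e₁ := ih₁ _ (H.blocksFirst_concat hπ hi hpos true) h₁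
    rw [pr_split i (fun x => gate (follow π x) = none)]
    simp only [follow_concat, List.length_append, List.length_cons, List.length_nil, zero_add,
      pow_succ] at e₀ e₁
    simp only [DTree.size, Nat.cast_add]
    refine le_trans (le_of_eq ?_) (div_le_div_of_nonneg_right (add_le_add e₀ e₁) zero_le_two)
    ring

include H in
lemma le_size [Fintype τ] [Fintype β] [Nonempty τ] (hm : 0 < m) (hρ : 0 ≤ ρ) {d : ℕ}
    (hd : d ≤ m * Fintype.card β) {S : DecisionTree n} {ε : ℝ}
    (hS : QueriesInfluential (gated gate (fun c => selectedParity sel (X c) (Y c)) g) S)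
    (herr : error S.eval (gated gate (fun c => selectedParity sel (X c) (Y c)) g) ≤ ε) :
    2 ^ d * (ρ * (Fintype.card β - d / m) * (1 - pr fun x => gate x = none) - 2 * ε) ≤
      S.size := by
  have h := H.le_error hm hρ hd S [] (fun c k hk => by simp [queried] at hk) hS
  simp only [restrictPath, follow, List.length_nil, pow_zero, mul_one] at h
  have h2 : (0 : ℝ) < 2 ^ d := by positivity
  rw [← le_div_iff₀' h2]
  linarith

end IsHardFamily

end gated

lemma DependsOn.influence_eq_zero {n : ℕ} {f : BoolFn n} {A : Set (Fin n)} (hf : DependsOn f A)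
    {i : Fin n} (hi : i ∉ A) : influence f i = 0 := by
  rw [influence_eq_zero_iff]
  intro x b
  refine hf fun j hj => Function.update_of_ne ?_ _ _
  rintro rfl
  exact hi hj

/-! ### Gates -/

/-- The first index `c` in a list whose variable `z c` is `1`. -/
def firstTrue {n : ℕ} {τ : Type} (z : τ → Fin n) (l : List τ) (x : Fin n → Bool) : Option τ :=
  l.find? fun c => x (z c)

section firstTrue

variable {n : ℕ} {τ : Type} {z : τ → Fin n} {F : τ → BoolFn n} {g : BoolFn n}

lemma dependsOn_firstTrue (l : List τ) : DependsOn (firstTrue z l) (Set.range z) := by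
  intro x y h
  have : ∀ c, x (z c) = y (z c) := fun c => h _ ⟨c, rfl⟩
  simp only [firstTrue, this]

lemma pr_firstTrue_eq_none {t : ℕ} {z : Fin t → Fin n} (hz : Function.Injective z) :
    pr (fun x => firstTrue z (List.finRange t) x = none) = (1 / 2) ^ t := by
  have h := pr_subcube_comp hz univ fun _ => false
  rw [card_univ, Fintype.card_fin] at h
  rw [← h]
  exact pr_congr fun x => by simp [firstTrue]

lemma gated_firstTrue_cons (c : τ) (l : List τ) :
    gated (firstTrue z (c :: l)) F g = mux (z c) (F c) (gated (firstTrue z l) F g) := by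
  funext x
  unfold gated firstTrue mux
  cases h : x (z c) <;> simp [h]

lemma influence_gated_eq_zero {l : List τ} {i : Fin n} (hz : ∀ c ∈ l, z c ≠ i)
    (hF : ∀ c ∈ l, influence (F c) i = 0) (hg : influence g i = 0) :
    influence (gated (firstTrue z l) F g) i = 0 := by
  induction l with
  | nil => exact hg
  | cons c l ih =>
    rw [gated_firstTrue_cons]
    exact influence_mux_eq_zero (hz c (by simp)) (hF c (by simp))
      (ih (fun c' hc' => hz c' (by simp [hc'])) fun c' hc' => hF c' (by simp [hc']))

/-- Iterates `dtSize_mux`: at each gate the two sides share no relevant variable, and as `F c` is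
not constant the degenerate case does not occur. -/
lemma dtSize_gated (hz : Function.Injective z) (hFz : ∀ c c', influence (F c) (z c') = 0)
    (hgz : ∀ c, influence g (z c) = 0)
    (hFF : ∀ c c' i, c ≠ c' → influence (F c) i = 0 ∨ influence (F c') i = 0)
    (hFg : ∀ c i, influence (F c) i = 0 ∨ influence g i = 0)
    (hF : ∀ c, ¬ ∃ a, ∀ x, F c x = a) (l : List τ) (hl : l.Nodup) :
    dtSize (gated (firstTrue z l) F g) = (l.map fun c => dtSize (F c)).sum + dtSize g := by
  induction l with
  | nil => simp only [List.map_nil, List.sum_nil, zero_add]; rfl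
  | cons c l ih =>
    rw [List.nodup_cons] at hl
    have hne : ∀ c' ∈ l, c' ≠ c := by
      rintro c' hc' rfl
      exact hl.1 hc'
    rw [gated_firstTrue_cons, dtSize_mux (hFz c c), ih hl.2, List.map_cons, List.sum_cons,
      add_assoc]
    · exact influence_gated_eq_zero (fun c' hc' => hz.ne (hne c' hc')) (fun c' _ => hFz c' c)
        (hgz c)
    · intro j
      by_cases hj : influence (F c) j = 0
      · exact Or.inl hj
      · refine Or.inr (influence_gated_eq_zero ?_ ?_ ?_)
        · rintro c' - rfl
          exact hj (hFz c c')
        · exact fun c' hc' => (hFF c' c j (hne c' hc')).resolve_right hj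
        · exact (hFg c j).resolve_left hj
    · rintro ⟨a, ha, -⟩
      exact hF c ⟨a, ha⟩

end firstTrue

/-! ### Decision tree size of selected parities -/

section selectedParity

variable {n m : ℕ} {κ β : Type} {sel : (κ → Bool) → Option β} {X : κ → Fin n}
  {Y : β → Fin m → Fin n}

lemma dependsOn_parityOn (y : Fin m → Fin n) : DependsOn (parityOn y) (Set.range y) := by
  intro x x' h
  unfold parityOn
  exact prod_congr rfl fun j _ => by rw [h _ ⟨j, rfl⟩]

lemma dependsOn_selectedParity :
    DependsOn (selectedParity sel X Y) (Set.range X ∪ Set.range fun q : β × Fin m => Y q.1 q.2) := by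
  intro x y h
  unfold selectedParity
  have h1 : (fun k => x (X k)) = fun k => y (X k) := funext fun k => h _ (Or.inl ⟨k, rfl⟩)
  have h2 : ∀ b, parityOn (Y b) x = parityOn (Y b) y := fun b =>
    dependsOn_parityOn (Y b) fun i ⟨j, hj⟩ => h i (Or.inr ⟨(b, j), hj⟩)
  simp only [h1, h2]

/-- The efficient tree, which greedy trees miss: read the selector, then only the selected block. -/
lemma dtSize_selectedParity_le [Fintype κ] (hXY : ∀ k b j, X k ≠ Y b j) :
    dtSize (selectedParity sel X Y) ≤ 2 ^ Fintype.card κ * 2 ^ m := by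
  classical
  refine (dtSize_le_two_pow_mul (univ.image X) (2 ^ m) _ fun v => ?_).trans
    (Nat.mul_le_mul_right _ (Nat.pow_le_pow_right two_pos card_image_le))
  have h1 : ∀ x k, (univ.image X).piecewise v x (X k) = v (X k) := fun x k =>
    piecewise_eq_of_mem _ _ _ (by simp)
  unfold selectedParity
  simp only [h1]
  cases sel fun k => v (X k) with
  | none => exact (dtSize_const fun _ => rfl).trans_le Nat.one_le_two_pow
  | some b =>
    simp only [Option.elim_some]
    refine (dtSize_le_two_pow (univ.image (Y b)) _ ?_).trans
      (Nat.pow_le_pow_right two_pos (card_image_le.trans_eq (by simp)))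
    intro x y h
    refine dependsOn_parityOn (Y b) ?_
    rintro _ ⟨j, rfl⟩
    have hn : Y b j ∉ univ.image X := by simpa using fun k => hXY k b j
    rw [piecewise_eq_of_notMem _ _ _ hn, piecewise_eq_of_notMem _ _ _ hn]
    exact h _ (by simp)

lemma selectedParity_not_const (hXY : ∀ k b j, X k ≠ Y b j) {b : β}
    (hY : Function.Injective (Y b)) {x : Fin n → Bool} (hx : sel (fun k => x (X k)) = some b)
    (j : Fin m) : ¬ ∃ a, ∀ x, selectedParity sel X Y x = a := by
  rintro ⟨a, ha⟩
  have h0 := ha x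
  have h1 := ha (flipAt x (Y b j))
  have h2 : ∀ k, flipAt x (Y b j) (X k) = x (X k) := fun k => flipAt_of_ne _ (hXY k b j)
  simp only [selectedParity, h2, hx, Option.elim_some, parityOn_flipAt hY] at h0 h1
  rw [h0] at h1
  obtain rfl | rfl := Int.units_eq_one_or a <;> exact absurd h1 (by decide)

end selectedParity

/-- By `1 - x ≤ exp (-x)` and `e ≥ 2`, among `2 ^ w` groups none is active with probability at most
1/2. -/
lemma one_sub_half_pow_pow_le (t w : ℕ) :
    (1 - (1 / 2 : ℝ) ^ w) ^ (t * 2 ^ w) ≤ (1 / 2) ^ t := by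
  have h1 : (1 / 2 : ℝ) ^ w ≤ 1 := pow_le_one₀ (by norm_num) (by norm_num)
  have h2 : (1 - (1 / 2 : ℝ) ^ w) ^ (2 ^ w) ≤ 1 / 2 := by
    have h3 : 1 - (1 / 2 : ℝ) ^ w ≤ Real.exp (-(1 / 2) ^ w) := by
      have := Real.add_one_le_exp (-(1 / 2 : ℝ) ^ w)
      linarith
    refine (pow_le_pow_left₀ (by linarith) h3 _).trans ?_
    rw [← Real.exp_nat_mul]
    have h4 : ((2 ^ w : ℕ) : ℝ) * -(1 / 2) ^ w = -1 := by
      push_cast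
      rw [mul_neg, ← mul_pow]
      norm_num
    rw [h4, Real.exp_neg, one_div]
    refine inv_anti₀ two_pos ?_
    have := Real.add_one_le_exp (1 : ℝ)
    linarith
  rw [mul_comm t, pow_mul]
  exact pow_le_pow_left₀ (pow_nonneg (by linarith) _) h2 t

/-- A function of prescribed decision tree size for which every tree that queries only influential
variables and has error at most `ε` is large. -/
theorem exists_hard {n t w p m s : ℕ} {ε : ℝ} (ht : 1 ≤ t) (hw : w = p + 3) (htp : t ≤ p)
    (hm : 0 < m)
    (hn : t + t * (t * 2 ^ w * (w + p)) + t * (2 ^ p * m) + 2 * Nat.log 2 s ≤ n)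
    (hs : t * (2 ^ (t * 2 ^ w * (w + p)) * 2 ^ m) < s) (hε : 4 * (1 / 2 : ℝ) ^ t ≤ 1 - 2 * ε) :
    ∃ f : BoolFn n, dtSize f = s ∧ ∀ S : DecisionTree n, QueriesInfluential f S →
      error S.eval f ≤ ε → (2 : ℝ) ^ (m * 2 ^ (p - t)) * (1 / 2) ^ t ≤ S.size := by
  -- Disjoint variables for the gates, the selectors, the blocks and the padding.
  obtain ⟨e⟩ : Nonempty ((Fin t ⊕ (Fin t × (Fin (t * 2 ^ w) × (Fin w ⊕ Fin p))) ⊕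
      (Fin t × (Fin p → Bool) × Fin m) ⊕ Fin (2 * Nat.log 2 s)) ↪ Fin n) := by
    refine Function.Embedding.nonempty_of_card_le ?_
    simp only [Fintype.card_sum, Fintype.card_prod, Fintype.card_fin, Fintype.card_fun,
      Fintype.card_bool]
    omega
  have he : ∀ {i j}, e i = e j ↔ i = j := e.injective.eq_iff
  let z : Fin t → Fin n := fun c => e (.inl c)
  let X : Fin t → Fin (t * 2 ^ w) × (Fin w ⊕ Fin p) → Fin n := fun c k => e (.inr (.inl (c, k)))
  let Y : Fin t → (Fin p → Bool) → Fin m → Fin n := fun c b j => e (.inr (.inr (.inl (c, b, j))))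
  let W : Finset (Fin n) := univ.image fun v => e (.inr (.inr (.inr v)))
  have hz : Function.Injective z := fun c c' h => by simpa [z, he] using h
  have hX : ∀ c, Function.Injective (X c) := fun c k k' h => by simpa [X, he] using h
  have hY : ∀ c b, Function.Injective (Y c b) := fun c b k k' h => by simpa [Y, he] using h
  have hXY : ∀ c k c' b j, X c k ≠ Y c' b j := by simp [X, Y, he]
  have hXW : ∀ c k, X c k ∉ W := by simp [X, W, he]
  have hzW : ∀ c, z c ∉ W := by simp [z, W, he]
  have hWcard : W.card = 2 * Nat.log 2 s := by
    rw [card_image_of_injective _ fun v v' h => by simpa [he] using h, card_univ, Fintype.card_fin]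
  let F : Fin t → BoolFn n := fun c => selectedParity firstPayload (X c) (Y c)
  have hFdep : ∀ c i, i ∉ Set.range (X c) ∪ Set.range (fun q : (Fin p → Bool) × Fin m =>
      Y c q.1 q.2) → influence (F c) i = 0 :=
    fun c i hi => DependsOn.influence_eq_zero dependsOn_selectedParity hi
  have hFle : ∀ c, dtSize (F c) ≤ 2 ^ (t * 2 ^ w * (w + p)) * 2 ^ m := by
    intro c
    refine (dtSize_selectedParity_le fun k b j => hXY c k c b j).trans_eq ?_
    simp
  have hsum : ((List.finRange t).map fun c => dtSize (F c)).sum < s := by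
    refine lt_of_le_of_lt ?_ hs
    refine (List.sum_le_card_nsmul _ (2 ^ (t * 2 ^ w * (w + p)) * 2 ^ m) ?_).trans_eq (by simp)
    simp only [List.mem_map]
    rintro _ ⟨c, -, rfl⟩
    exact hFle c
  obtain ⟨g, hgW, hg⟩ := exists_dtSize_eq
    (s - ((List.finRange t).map fun c => dtSize (F c)).sum) (by omega) W (by
      rw [hWcard]
      exact Nat.mul_le_mul_left 2 (Nat.log_mono_right (by omega)))
  have hfail := one_sub_half_pow_pow_le t w
  have hhalf : (1 / 2 : ℝ) ^ t ≤ 1 / 2 := by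
    simpa using pow_le_pow_of_le_one (by norm_num : (0 : ℝ) ≤ 1 / 2) (by norm_num) ht
  have hhalf0 : (0 : ℝ) < (1 / 2) ^ t := by positivity
  set ρ : ℝ := (1 - (1 - (1 / 2) ^ w) ^ (t * 2 ^ w)) / 2 ^ p with hρ
  -- Some group is active with probability at least 1/2, so `ρ ≥ (1/2) ^ (p + 1)`. The choice `w = p
  -- + 3` makes the sensitivity bound `(1/2) ^ (p + 2)`.
  have hρlt : (1 / 2 : ℝ) ^ (w - 1) < ρ := by
    rw [hρ, lt_div_iff₀ (by positivity), show w - 1 = p + 2 by omega, pow_add, mul_right_comm,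
      ← mul_pow]
    norm_num at hfail hhalf ⊢
    linarith
  have hρ0 : 0 < ρ := lt_trans (by positivity) hρlt
  have hFconst : ∀ c, ¬ ∃ a, ∀ x, F c x = a := by
    intro c
    let b : Fin p → Bool := fun _ => true
    obtain ⟨x, hx⟩ := exists_of_pr_pos (hρ0.trans_eq (pr_firstPayload_eq_some (hX c) b).symm)
    exact selectedParity_not_const (fun k b j => hXY c k c b j) (hY c b) hx ⟨0, hm⟩
  have H : IsHardFamily (firstTrue z (List.finRange t)) g firstPayload X Y (Set.range z) ρ :=
    { dependsOn_gate := dependsOn_firstTrue _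
      X_notMem := by simp [X, z, he]
      Y_notMem := by simp [Y, z, he]
      Y_injective := fun q q' h => by simpa [Y, he, Prod.ext_iff] using h
      X_ne_Y := hXY
      X_injective := fun q q' h => by simpa [X, he, Prod.ext_iff] using h
      influence_g := fun c k => hgW _ (hXW c k)
      pr_sel := fun c b => pr_firstPayload_eq_some (hX c) b
      pr_sel_flipAt := fun c k => (pr_firstPayload_flipAt_le (hX c) k).trans_lt hρlt }
  refine ⟨gated (firstTrue z (List.finRange t)) F g, ?_, fun S hS herr => ?_⟩
  · rw [dtSize_gated hz ?_ (fun c => hgW _ (hzW c)) ?_ ?_ hFconst _ (List.nodup_finRange t), hg]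
    · omega
    · intro c c'
      exact hFdep c _ (by simp [X, Y, z, he])
    · intro c c' i hcc
      by_contra! hc
      have h1 := not_imp_comm.1 (hFdep c i) hc.1
      have h2 := not_imp_comm.1 (hFdep c' i) hc.2
      obtain ⟨k, rfl⟩ | ⟨q, rfl⟩ := h1
      · obtain ⟨k', h⟩ | ⟨q', h⟩ := h2
        · simp only [X, he, Sum.inr.injEq, Sum.inl.injEq, Prod.mk.injEq] at h
          exact hcc h.1.symm
        · exact hXY _ _ _ _ _ h.symm
      · obtain ⟨k', h⟩ | ⟨q', h⟩ := h2
        · exact hXY _ _ _ _ _ h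
        · simp only [Y, he, Sum.inr.injEq, Sum.inl.injEq, Prod.mk.injEq] at h
          exact hcc h.1.symm
    · intro c i
      by_cases hi : i ∈ W
      · left
        obtain ⟨v, -, rfl⟩ := mem_image.1 hi
        exact hFdep c _ (by simp [X, Y, he])
      · exact Or.inr (hgW i hi)
  · have : Nonempty (Fin t) := ⟨⟨0, ht⟩⟩
    have hm' : (0 : ℝ) < m := by exact_mod_cast hm
    have hp : (2 : ℝ) ^ p = 2 ^ (p - t) * 2 ^ t := by rw [← pow_add, Nat.sub_add_cancel htp]
    -- This `d` is the fraction `(1/2) ^ t` of the block variables of one copy, so above depth `d`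
    -- only that fraction of its blocks can be finished.
    have h := H.le_size hm hρ0.le (d := m * 2 ^ (p - t))
      (by simpa using Nat.mul_le_mul_left m (Nat.pow_le_pow_right two_pos (Nat.sub_le p t))) hS herr
    rw [pr_firstTrue_eq_none hz] at h
    refine le_trans ?_ h
    refine mul_le_mul_of_nonneg_left ?_ (by positivity)
    have hβ : ρ * ((Fintype.card (Fin p → Bool) : ℝ) - ((m * 2 ^ (p - t) : ℕ) : ℝ) / m) =
        (1 - (1 - (1 / 2) ^ w) ^ (t * 2 ^ w)) * (1 - (1 / 2) ^ t) := by
      simp only [Fintype.card_fun, Fintype.card_fin, Fintype.card_bool]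
      push_cast
      rw [mul_div_cancel_left₀ _ hm'.ne', hρ]
      generalize (1 - (1 / 2 : ℝ) ^ w) ^ (t * 2 ^ w) = A
      rw [hp, one_div_pow]
      field_simp
    rw [hβ]
    set A := (1 - (1 / 2 : ℝ) ^ w) ^ (t * 2 ^ w)
    set u := (1 / 2 : ℝ) ^ t
    -- There are three losses of at most `u` each: no active group, finished blocks, the fallback.
    -- As `(1 - u) ^ 3 ≥ 1 - 3 * u`, the assumption `4 * u ≤ 1 - 2 * ε` leaves `u`.
    have h1 : (1 - u) * ((1 - u) * (1 - u)) ≤ (1 - A) * ((1 - u) * (1 - u)) :=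
      mul_le_mul_of_nonneg_right (by linarith) (mul_self_nonneg _)
    nlinarith [mul_nonneg hhalf0.le (mul_nonneg hhalf0.le (by linarith : (0 : ℝ) ≤ 3 - u))]

/-! ### The choice of the parameters -/

lemma succ_sq_le_two_pow {k : ℕ} (hk : 6 ≤ k) : (k + 1) ^ 2 ≤ 2 ^ k := by
  induction k, hk using Nat.le_induction with
  | base => norm_num
  | succ k hk ih =>
    rw [pow_succ 2 k]
    nlinarith

/-- If `2 ^ Λ` is at most `2 ^ Õ(√n)`, then `n` is at least `Λ²` up to logarithmic factors. -/
lemma sq_le_mul_log_pow {C : ℝ} {a n Λ l : ℕ} (hC : 0 < C) (hΛ : Λ < 2 ^ (l + 1))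
    (hl1 : 1 ≤ l) (hl : C * 4 ^ a < l) (hΛ0 : 0 < Λ)
    (h : (Λ : ℝ) ≤ C * √(n : ℝ) * (Real.logb 2 n) ^ a) :
    Λ ^ 2 ≤ n * l ^ (2 * a + 2) := by
  by_contra! hc
  have hc' : (n : ℝ) * l ^ (2 * a + 2) < (Λ : ℝ) ^ 2 := by exact_mod_cast hc
  have hl1' : (1 : ℝ) ≤ l := by exact_mod_cast hl1
  have hl0 : (0 : ℝ) < l := by linarith
  have hΛ0' : (0 : ℝ) < Λ := by exact_mod_cast hΛ0
  have hsqrt : √(n : ℝ) * l ^ (a + 1) < Λ := by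
    refine lt_of_pow_lt_pow_left₀ 2 hΛ0'.le ?_
    rw [mul_pow, Real.sq_sqrt (Nat.cast_nonneg n), ← pow_mul,
      show (a + 1) * 2 = 2 * a + 2 by ring]
    exact hc'
  have hn : (n : ℝ) ≤ 2 ^ (4 * l) := by
    have h1 : n < Λ ^ 2 := lt_of_le_of_lt (Nat.le_mul_of_pos_right n (by positivity)) hc
    have h2 : Λ ^ 2 ≤ (2 ^ (l + 1)) ^ 2 := Nat.pow_le_pow_left hΛ.le 2
    have h3 : (2 ^ (l + 1)) ^ 2 ≤ 2 ^ (4 * l) := by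
      rw [← pow_mul]
      exact Nat.pow_le_pow_right two_pos (by omega)
    exact_mod_cast h1.le.trans (h2.trans h3)
  have hlog0 : 0 ≤ Real.logb 2 n := by
    obtain rfl | hn0 := Nat.eq_zero_or_pos n
    · simp
    · exact Real.logb_nonneg (by norm_num) (by exact_mod_cast hn0)
  have hlog : Real.logb 2 n ≤ 4 * l := by
    obtain rfl | hn0 := Nat.eq_zero_or_pos n
    · simp
    · rw [Real.logb_le_iff_le_rpow (by norm_num) (by exact_mod_cast hn0)]
      exact_mod_cast hn
  -- If `n` were too small, `log n` would be at most `4 * l`, and the bound on `Λ` would contradict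
  -- `C * 4 ^ a < l`.
  have h1 : (Λ : ℝ) * l ≤ C * 4 ^ a * Λ := by
    calc (Λ : ℝ) * l ≤ C * √(n : ℝ) * (Real.logb 2 n) ^ a * l := by gcongr
      _ ≤ C * √(n : ℝ) * (4 * l) ^ a * l := by gcongr
      _ = C * 4 ^ a * (√(n : ℝ) * l ^ (a + 1)) := by ring
      _ ≤ C * 4 ^ a * Λ := by gcongr
  rw [mul_comm] at h1
  exact absurd (le_of_mul_le_mul_right h1 hΛ0') (not_le.2 hl)

/-- `Λ`, `l` and `μ` are the rounded once, twice and three times iterated logarithms of `s`. Blocks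
have `m = 2 ^ (l - 2) ≤ Λ / 4` variables, and `2 ^ p` is `Λ` divided by about `l ^ B`. So selector
and block fit into size `s`, the variables number at most `Λ² / l ^ (2 * a + 2) ≤ n`, and `d` is at
least of order `Λ² / l ^ (B + 1)`. -/
theorem exists_approximate {C : ℝ} (a : ℕ) (hC : 0 < C) {ε : ℝ} (hε : ε < 1 / 2) :
    ∃ s₀ : ℕ, ∀ n s : ℕ, s₀ ≤ s →
      (s : ℝ) ≤ (2 : ℝ) ^ (C * √(n : ℝ) * (Real.logb 2 (n : ℝ)) ^ a) →
      ∃ f : BoolFn n, dtSize f = s ∧ ∀ S : DecisionTree n, QueriesInfluential f S →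
        error S.eval f ≤ ε →
        (s : ℝ) ^ (1 * Real.logb 2 (s : ℝ) / (Real.logb 2 (Real.logb 2 (s : ℝ))) ^ (2 * a + 4)) ≤
          (S.size : ℝ) := by
  obtain ⟨t₀, ht₀⟩ := exists_pow_lt_of_lt_one (show (0 : ℝ) < (1 - 2 * ε) / 4 by linarith)
    (show (1 / 2 : ℝ) < 1 by norm_num)
  obtain ⟨t, ht, htε⟩ : ∃ t : ℕ, 1 ≤ t ∧ 4 * (1 / 2 : ℝ) ^ t ≤ 1 - 2 * ε := by
    refine ⟨t₀ + 1, by omega, ?_⟩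
    have : (1 / 2 : ℝ) ^ (t₀ + 1) ≤ (1 / 2) ^ t₀ :=
      pow_le_pow_of_le_one (by norm_num) (by norm_num) (by omega)
    linarith
  obtain ⟨K, hK⟩ := exists_nat_ge (C * 4 ^ a)
  -- The power `2 * a + 2` is what `sq_le_mul_log_pow` costs; one more factor `l` absorbs constants
  -- such as `5 * t`.
  set B := 2 * a + 3 with hB
  set μ₀ := B + t + 9 + K with hμ₀
  -- This threshold makes even the triple logarithm `μ` at least `μ₀`.
  refine ⟨2 ^ 2 ^ 2 ^ μ₀, fun n s hs hsn => ?_⟩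
  have hs0 : s ≠ 0 := ((Nat.two_pow_pos _).trans_le hs).ne'
  set Λ := Nat.log 2 s with hΛ
  have hΛge : 2 ^ 2 ^ μ₀ ≤ Λ := Nat.le_log_of_pow_le one_lt_two hs
  have hΛ0 : Λ ≠ 0 := ((Nat.two_pow_pos _).trans_le hΛge).ne'
  set l := Nat.log 2 Λ with hl
  have hlge : 2 ^ μ₀ ≤ l := Nat.le_log_of_pow_le one_lt_two hΛge
  have hl0 : l ≠ 0 := ((Nat.two_pow_pos _).trans_le hlge).ne'
  set μ := Nat.log 2 l with hμ
  have hμge : μ₀ ≤ μ := Nat.le_log_of_pow_le one_lt_two hlge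
  have hsΛ : 2 ^ Λ ≤ s := Nat.pow_log_le_self 2 hs0
  have hsΛ' : s < 2 ^ (Λ + 1) := Nat.lt_pow_succ_log_self one_lt_two s
  have hΛl : 2 ^ l ≤ Λ := Nat.pow_log_le_self 2 hΛ0
  have hΛl' : Λ < 2 ^ (l + 1) := Nat.lt_pow_succ_log_self one_lt_two Λ
  have hlμ : 2 ^ μ ≤ l := Nat.pow_log_le_self 2 hl0
  have hlμ' : l < 2 ^ (μ + 1) := Nat.lt_pow_succ_log_self one_lt_two l
  have hBl : B * (μ + 1) + t + 6 ≤ l := by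
    have h1 := (succ_sq_le_two_pow (show 6 ≤ μ by omega)).trans hlμ
    have h2 : (B + t + 6) * (μ + 1) ≤ (μ + 1) ^ 2 := by
      rw [pow_two]
      exact Nat.mul_le_mul_right _ (by omega)
    nlinarith
  -- As `l < 2 ^ (μ + 1)`, the term `B * (μ + 1)` makes room for the factor `l ^ B` next to `2 ^ (p
  -- + 3)`.
  obtain ⟨p, hp⟩ : ∃ p, l = B * (μ + 1) + (p + 3) := ⟨l - B * (μ + 1) - 3, by omega⟩
  have htp : t + 3 ≤ p := by omega
  have h2w : 2 ^ (p + 3) * l ^ B ≤ Λ := by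
    calc 2 ^ (p + 3) * l ^ B ≤ 2 ^ (p + 3) * (2 ^ (μ + 1)) ^ B :=
          Nat.mul_le_mul_left _ (Nat.pow_le_pow_left hlμ'.le B)
      _ = 2 ^ l := by rw [← pow_mul, ← pow_add, hp]; ring_nf
      _ ≤ Λ := hΛl
  have htl : 2 ^ (B + 9 + t) ≤ l :=
    (Nat.pow_le_pow_right two_pos (by omega)).trans hlge
  have htl' : 2 ^ (B + 9) * t ≤ l := by
    refine le_trans ?_ htl
    rw [pow_add 2 (B + 9)]
    exact Nat.mul_le_mul_left _ Nat.lt_two_pow_self.le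
  have h512 : 512 * t ≤ l := by
    refine le_trans (Nat.mul_le_mul_right t ?_) htl'
    rw [pow_add]
    exact Nat.le_mul_of_pos_left _ (by positivity)
  have hm4 : 4 * 2 ^ (l - 2) ≤ Λ := by
    refine le_trans (le_of_eq ?_) hΛl
    rw [show 4 = 2 ^ 2 by norm_num, ← pow_add]
    congr 1
    omega
  have hlΛ : l ≤ Λ := Nat.lt_two_pow_self.le.trans hΛl
  have hwp : p + 3 + p ≤ 2 * l := by omega
  have hsel : 4 * (t * 2 ^ (p + 3) * (p + 3 + p)) ≤ Λ := by
    have h1 : l ^ 3 ≤ l ^ B := Nat.pow_le_pow_right (by omega) (by omega)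
    calc 4 * (t * 2 ^ (p + 3) * (p + 3 + p)) ≤ 4 * (t * 2 ^ (p + 3) * (2 * l)) := by gcongr
      _ = 2 ^ (p + 3) * (8 * t * l) := by ring
      _ ≤ 2 ^ (p + 3) * (l * l ^ 2) := by
        refine Nat.mul_le_mul_left _ ?_
        rw [pow_two, ← mul_assoc]
        exact Nat.mul_le_mul_right _ ((show 8 * t ≤ l by omega).trans
          (Nat.le_mul_of_pos_right l (by omega)))
      _ = 2 ^ (p + 3) * l ^ 3 := by ring
      _ ≤ 2 ^ (p + 3) * l ^ B := Nat.mul_le_mul_left _ h1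
      _ ≤ Λ := h2w
  have hsize : t * (2 ^ (t * 2 ^ (p + 3) * (p + 3 + p)) * 2 ^ 2 ^ (l - 2)) < s := by
    refine lt_of_lt_of_le ?_ hsΛ
    calc t * (2 ^ (t * 2 ^ (p + 3) * (p + 3 + p)) * 2 ^ 2 ^ (l - 2))
        < 2 ^ t * (2 ^ (t * 2 ^ (p + 3) * (p + 3 + p)) * 2 ^ 2 ^ (l - 2)) :=
          Nat.mul_lt_mul_of_pos_right Nat.lt_two_pow_self (by positivity)
      _ = 2 ^ (t + (t * 2 ^ (p + 3) * (p + 3 + p) + 2 ^ (l - 2))) := by rw [← pow_add, ← pow_add]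
      _ ≤ 2 ^ Λ := Nat.pow_le_pow_right two_pos (by omega)
  have hs0' : (0 : ℝ) < s := by exact_mod_cast Nat.pos_of_ne_zero hs0
  have hΛL : (Λ : ℝ) ≤ Real.logb 2 s := by
    rw [Real.le_logb_iff_rpow_le (by norm_num) hs0']
    exact_mod_cast hsΛ
  have hLΛ : Real.logb 2 s ≤ Λ + 1 := by
    rw [Real.logb_le_iff_le_rpow (by norm_num) hs0']
    exact_mod_cast hsΛ'.le
  have hn : Λ ^ 2 ≤ n * l ^ (2 * a + 2) := by
    refine sq_le_mul_log_pow hC hΛl' (Nat.pos_of_ne_zero hl0) ?_ (Nat.pos_of_ne_zero hΛ0)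
      (hΛL.trans ?_)
    · have h1 : K < l := (Nat.lt_two_pow_self (n := K)).trans_le
        ((Nat.pow_le_pow_right two_pos (by omega)).trans hlge)
      exact hK.trans_lt (by exact_mod_cast h1)
    · rw [Real.logb_le_iff_le_rpow (by norm_num) hs0']
      exact hsn
  have hvars : t + t * (t * 2 ^ (p + 3) * (p + 3 + p)) + t * (2 ^ p * 2 ^ (l - 2)) +
      2 * Nat.log 2 s ≤ n := by
    rw [← hΛ]
    have h1 : t + t * (t * 2 ^ (p + 3) * (p + 3 + p)) + t * (2 ^ p * 2 ^ (l - 2)) + 2 * Λ ≤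
        5 * t * 2 ^ (p + 3) * Λ := by
      have h2 : t * (t * 2 ^ (p + 3) * (p + 3 + p)) ≤ t * Λ := Nat.mul_le_mul_left t (by omega)
      have h3 : t * (2 ^ p * 2 ^ (l - 2)) ≤ t * (2 ^ (p + 3) * Λ) :=
        Nat.mul_le_mul_left t (Nat.mul_le_mul (Nat.pow_le_pow_right two_pos (by omega)) (by omega))
      have h4 : t * Λ ≤ t * (2 ^ (p + 3) * Λ) :=
        Nat.mul_le_mul_left t (Nat.le_mul_of_pos_left Λ (by positivity))
      have h5 : Λ ≤ t * Λ := Nat.le_mul_of_pos_left Λ ht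
      have h6 : t ≤ t * Λ := Nat.le_mul_of_pos_right t (Nat.pos_of_ne_zero hΛ0)
      calc _ ≤ 5 * (t * (2 ^ (p + 3) * Λ)) := by omega
        _ = _ := by ring
    refine h1.trans (Nat.le_of_mul_le_mul_right (?_ : _ * l ^ (2 * a + 2) ≤ _)
      (by positivity : 0 < l ^ (2 * a + 2)))
    calc 5 * t * 2 ^ (p + 3) * Λ * l ^ (2 * a + 2)
        = 2 ^ (p + 3) * (5 * t * l ^ (2 * a + 2)) * Λ := by ring
      _ ≤ 2 ^ (p + 3) * (l * l ^ (2 * a + 2)) * Λ := by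
        gcongr
        omega
      _ = 2 ^ (p + 3) * l ^ B * Λ := by rw [hB]; ring
      _ ≤ Λ * Λ := Nat.mul_le_mul_right _ h2w
      _ = Λ ^ 2 := by ring
      _ ≤ n * l ^ (2 * a + 2) := hn
  obtain ⟨f, hf, hS⟩ := exists_hard ht rfl (by omega : t ≤ p) (Nat.two_pow_pos (l - 2)) hvars hsize
    htε
  refine ⟨f, hf, fun S hSq hSe => le_trans ?_ (hS S hSq hSe)⟩
  set d := 2 ^ (l - 2) * 2 ^ (p - t) with hd
  have hdt : 2 * t ≤ d := by
    have h1 : l - 2 < 2 ^ (l - 2) := Nat.lt_two_pow_self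
    have h2 : 2 ^ (l - 2) ≤ d := Nat.le_mul_of_pos_right _ (by positivity)
    omega
  -- The power `l ^ B ≥ 2 ^ (μ * B)` repays what `p` lost, up to `2 ^ B`; the last factor `l` pays
  -- for `2 ^ B`, `2 ^ t` and the constants.
  have hdl : 2 ^ (2 * l + 3) ≤ d * l ^ (B + 1) := by
    have h1 : 2 ^ (μ * B) * 2 ^ (B + 9 + t) ≤ l ^ (B + 1) := by
      rw [pow_succ, pow_mul]
      exact Nat.mul_le_mul (Nat.pow_le_pow_left hlμ B) htl
    refine le_trans ?_ (Nat.mul_le_mul_left d h1)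
    rw [hd, ← pow_add, ← pow_add, ← pow_add]
    refine Nat.pow_le_pow_right two_pos ?_
    have : B * (μ + 1) = μ * B + B := by ring
    omega
  have hloglog : (l : ℝ) ≤ Real.logb 2 (Real.logb 2 s) := by
    have h1 : (0 : ℝ) < Λ := by exact_mod_cast Nat.pos_of_ne_zero hΛ0
    rw [Real.le_logb_iff_rpow_le (by norm_num) (h1.trans_le hΛL)]
    refine le_trans ?_ hΛL
    exact_mod_cast hΛl
  have hL0 : 0 ≤ Real.logb 2 (s : ℝ) := (Nat.cast_nonneg _).trans hΛL
  have hL : Real.logb 2 (s : ℝ) ≤ 2 ^ (l + 1) := by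
    refine hLΛ.trans ?_
    exact_mod_cast hΛl'
  have hlpos : (0 : ℝ) < l := by exact_mod_cast Nat.pos_of_ne_zero hl0
  have hdl' : (2 : ℝ) ^ (2 * l + 3) ≤ d * l ^ (B + 1) := by exact_mod_cast hdl
  have hdt' : 2 * (t : ℝ) ≤ d := by exact_mod_cast hdt
  have hexp : Real.logb 2 (s : ℝ) *
      (1 * Real.logb 2 (s : ℝ) / (Real.logb 2 (Real.logb 2 (s : ℝ))) ^ (2 * a + 4)) ≤
        (d : ℝ) - t := by
    have h1 : Real.logb 2 (s : ℝ) *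
        (1 * Real.logb 2 (s : ℝ) / (Real.logb 2 (Real.logb 2 (s : ℝ))) ^ (2 * a + 4)) ≤
        2 ^ (l + 1) * (1 * 2 ^ (l + 1) / (l : ℝ) ^ (B + 1)) := by
      rw [hB]
      gcongr
      exact div_nonneg (by linarith) (pow_nonneg (hlpos.le.trans hloglog) _)
    have h2 : (2 : ℝ) ^ (l + 1) * (1 * 2 ^ (l + 1) / (l : ℝ) ^ (B + 1)) ≤ d / 2 := by
      rw [one_mul, mul_div_assoc', div_le_iff₀ (by positivity), ← pow_add]
      have h3 : (2 : ℝ) ^ (2 * l + 3) = 2 * 2 ^ (l + 1 + (l + 1)) := by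
        rw [← pow_succ']
        congr 1
        omega
      linarith
    linarith
  calc (s : ℝ) ^ (1 * Real.logb 2 (s : ℝ) /
        (Real.logb 2 (Real.logb 2 (s : ℝ))) ^ (2 * a + 4))
      = (2 : ℝ) ^ (Real.logb 2 (s : ℝ) * (1 * Real.logb 2 (s : ℝ) /
          (Real.logb 2 (Real.logb 2 (s : ℝ))) ^ (2 * a + 4))) := by
        rw [Real.rpow_mul (by norm_num), Real.rpow_logb (by norm_num) (by norm_num) hs0']
    _ ≤ (2 : ℝ) ^ ((d : ℝ) - t) := Real.rpow_le_rpow_of_exponent_le (by norm_num) hexp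
    _ = 2 ^ d * (1 / 2) ^ t := by
        rw [Real.rpow_sub (by norm_num), Real.rpow_natCast, Real.rpow_natCast, one_div_pow,
          mul_one_div]

end TopDown

theorem theorem2 :
    -- (a) exact representation
    (∃ c₁ c₂ c₃ : ℝ, 0 < c₁ ∧ 0 < c₂ ∧ 0 < c₃ ∧
      ∀ n : ℕ, 1 ≤ n → ∃ f : TopDown.BoolFn n,
        c₁ * (n : ℝ) ≤ (TopDown.dtSize f : ℝ) ∧ (TopDown.dtSize f : ℝ) ≤ c₂ * (n : ℝ) ∧
        (2 : ℝ) ^ (c₃ * (TopDown.dtSize f : ℝ)) ≤ (TopDown.topDownDTSize f 0 : ℝ)) ∧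
    -- (b) approximate representation
    (∀ (C : ℝ) (a : ℕ), 0 < C → ∃ (c : ℝ) (b : ℕ), 0 < c ∧
      ∀ ε : ℝ, 0 < ε → ε < 1 / 2 → ∃ s₀ : ℕ, ∀ n s : ℕ, s₀ ≤ s →
        (s : ℝ) ≤ (2 : ℝ) ^ (C * √(n : ℝ) * (Real.logb 2 (n : ℝ)) ^ a) →
        ∃ f : TopDown.BoolFn n, TopDown.dtSize f = s ∧
          (s : ℝ) ^ (c * Real.logb 2 (s : ℝ) / (Real.logb 2 (Real.logb 2 (s : ℝ))) ^ b) ≤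
            (TopDown.topDownDTSize f ε : ℝ) ∧
          ∀ T : TopDown.DecisionTree n, TopDown.IsTopDownOutput f 0 T →
            ∀ S : TopDown.DecisionTree n, TopDown.IsPruning S T → TopDown.error S.eval f ≤ ε →
              (s : ℝ) ^ (c * Real.logb 2 (s : ℝ) / (Real.logb 2 (Real.logb 2 (s : ℝ))) ^ b) ≤
                (S.size : ℝ)) := by
  refine ⟨⟨1 / 16, 40, 1 / 40, by norm_num, by norm_num, by norm_num,
    fun n hn => TopDown.exists_exact hn⟩, fun C a hC => ⟨1, 2 * a + 4, one_pos, fun ε hε hε' => ?_⟩⟩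
  obtain ⟨s₀, hs₀⟩ := TopDown.exists_approximate a hC hε'
  refine ⟨s₀, fun n s hs hsn => ?_⟩
  obtain ⟨f, hf, hS⟩ := hs₀ n s hs hsn
  refine ⟨f, hf, ?_, fun T hT S hST herr => ?_⟩
  · obtain ⟨T, hT, herr, hsize⟩ := TopDown.exists_size_eq_topDownDTSize f hε.le
    rw [← hsize]
    exact hS T hT herr
  · exact hS S ((hT.queriesInfluential le_rfl).1.pruning hST) herr
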